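/- Let $(G,+)$ be a countably infinite abelian group and let $(X,\mathcal A,\mu,(T_g)_{g\in G})$ be a measure preserving system: $(X,\mathcal A,\mu)$ is a separable probability space (some countable family of measurable sets is dense in $\mathcal A$ for the pseudometric $\mu(A\triangle B)$), and $(T_g)_{g\in G}$ is an action of $G$ on $X$ by measurable maps preserving $\mu$. Let $\ell\in\mathbb N=\{1,2,\dots\}$. Terminology. For an abelian group $H$, a Følner sequence in $H$ is a sequence $(F_k)_{k\in\mathbb N}$ of non-empty finite subsets of $H$ with $\lim_{k\to\infty}|(h+F_k)\cap F_k|/|F_k|=1$ for every $h\in H$; for $E\subseteq H$ put $\overline d_{(F_k)}(E)=\limsup_{k\to\infty}|E\cap F_k|/|F_k|$; and $E$ has uniform density one if $\overline d_{(F_k)}(E)=1$ for every Følner sequence $(F_k)$ in $H$. For a sequence $(g_k)_{k\in\mathbb N}$ in $G$, $\lim_{k\to\infty} g_k=\infty$ means that for every finite $K\subseteq G$ one has $g_k\notin K$ for all large $k$. A sequence $(\mathbf g_k)=(g_{k,1},\dots,g_{k,m})$ in $G^m$ is non-degenerated if $\lim_{k\to\infty} g_{k,t}=\infty$ for each $t$;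 two sequences $(\mathbf g_k),(\mathbf h_k)$ in $G^m$ are essentially distinct if $\lim_{k\to\infty}(g_{k,t}-h_{k,t})=\infty$ for each $t$. Let $\mathbb N^{(m)}$ be the set of $m$-element subsets of $\mathbb N$; for $\alpha=\{k_1<\dots<k_m\}\in\mathbb N^{(m)}$ put $g_\alpha=g_{k_1,1}+g_{k_2,2}+\cdots+g_{k_m,m}$. For real numbers $x_\alpha$ ($\alpha\in\mathbb N^{(m)}$) and $x$, $\mathcal R\text{-}\lim_{\alpha\in\mathbb N^{(m)}}x_\alpha=x$ means that for every $\epsilon>0$ there is $\alpha_0\in\mathbb N^{(m)}$ such that $|x_\alpha-x|<\epsilon$ for all $\alpha\in\mathbb N^{(m)}$ with $\min\alpha>\max\alpha_0$. A sequence $(S_k)_{k\in\mathbb N}$ of measure preserving transformations of $X$ has the mixing property if $\lim_{k\to\infty}\mu(A_0\cap S_k^{-1}A_1)=\mu(A_0)\mu(A_1)$ for all $A_0,A_1\in\mathcal A$. The action $(T_g)$ is weakly mixing if the diagonal action $(T_g\times T_g)_{g\in G}$ on $(X\times X,\mathcal A\otimes\mathcal A,\mu\otimes\mu)$ is ergodic.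 Theorem. The following statements are equivalent: (i) $(T_g)_{g\in G}$ is weakly mixing. (ii) For any Følner sequence $(F_k)_{k\in\mathbb N}$ in $G^\ell$, any $E\subseteq G^\ell$ with $\overline d_{(F_k)}(E)>0$ and any $m\in\mathbb N$, there exist non-degenerated and pairwise essentially distinct sequences $(\mathbf g^{(j)}_k)_{k\in\mathbb N}=(g^{(j)}_{k,1},\dots,g^{(j)}_{k,m})_{k\in\mathbb N}$, $j\in\{1,\dots,\ell\}$, in $G^m$ such that: (a) $\{(g^{(1)}_\alpha,\dots,g^{(\ell)}_\alpha)\mid\alpha\in\mathbb N^{(m)}\}\subseteq E$; (b) for any $t\in\{1,\dots,m\}$ and any $j\in\{1,\dots,\ell\}$, $(T_{g^{(j)}_{k,t}})_{k\in\mathbb N}$ has the mixing property; (c) for any $t\in\{1,\dots,m\}$ and any $i\neq j$ in $\{1,\dots,\ell\}$, $(T_{g^{(j)}_{k,t}-g^{(i)}_{k,t}})_{k\in\mathbb N}$ has the mixing property. (iii) For any Følner sequence $(F_k)_{k\in\mathbb N}$ in $G^\ell$ and any $E\subseteq G^\ell$ with $\overline d_{(F_k)}(E)>0$, there exist $m\in\mathbb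 N$ and sequences $(\mathbf g^{(1)}_k)_{k\in\mathbb N},\dots,(\mathbf g^{(\ell)}_k)_{k\in\mathbb N}$ in $G^m$ with $\{(g^{(1)}_\alpha,\dots,g^{(\ell)}_\alpha)\mid\alpha\in\mathbb N^{(m)}\}\subseteq E$ such that for any $A_0,\dots,A_\ell\in\mathcal A$, $$\mathop{\mathcal R\text{-}\lim}_{\alpha\in\mathbb N^{(m)}}\mu\bigl(A_0\cap T_{g^{(1)}_\alpha}A_1\cap\cdots\cap T_{g^{(\ell)}_\alpha}A_\ell\bigr)=\prod_{j=0}^{\ell}\mu(A_j).$$ (iv) For any $A_0,\dots,A_\ell\in\mathcal A$ and any $\epsilon>0$, the set $$R_\epsilon(A_0,\dots,A_\ell)=\Bigl\{(g_1,\dots,g_\ell)\in G^\ell\;\Big|\;\Bigl|\mu(A_0\cap T_{g_1}A_1\cap\cdots\cap T_{g_\ell}A_\ell)-\prod_{j=0}^{\ell}\mu(A_j)\Bigr|<\epsilon\Bigr\}$$ has uniform density one. -/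

import Mathlib

open MeasureTheory Filter Topology
open scoped Pointwise

noncomputable section

namespace AbelianMixing

section Sequences

variable {G : Type*} [AddCommGroup G]

/-- A sequence of non-empty finite subsets `F k` of a (discrete) abelian group is a Følner sequence
if `|(g + F k) ∩ F k| / |F k| → 1` for every `g`. -/
def IsFolnerSeq (F : ℕ → Finset G) : Prop :=
  (∀ k, (F k).Nonempty) ∧
    ∀ g : G, Tendsto
      (fun k => (((g +ᵥ (F k : Set G)) ∩ (F k : Set G)).ncard : ℝ) / ((F k).card : ℝ)) atTop (𝓝 1)

/-- The upper density of `E` along `(F k)`. -/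
def upperDensity (F : ℕ → Finset G) (E : Set G) : ℝ :=
  limsup (fun k => ((E ∩ (F k : Set G)).ncard : ℝ) / ((F k).card : ℝ)) atTop

/-- `E` has uniform density one if its upper density is one along every Følner sequence. -/
def HasUniformDensityOne (E : Set G) : Prop :=
  ∀ F : ℕ → Finset G, IsFolnerSeq F → upperDensity F E = 1

/-- `lim g k = ∞`: the sequence eventually leaves every finite subset of `G`. -/
def TendsToInfinity (g : ℕ → G) : Prop :=
  Tendsto g atTop cofinite

/-- A sequence in `G ^ m` is non-degenerated if each of its coordinates tends to infinity. -/
def NonDegenerated {m : ℕ} (g : ℕ → Fin m → G) : Prop :=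
  ∀ t : Fin m, TendsToInfinity fun k => g k t

/-- Two sequences in `G ^ m` are essentially distinct if in each coordinate they grow apart. -/
def EssentiallyDistinct {m : ℕ} (g h : ℕ → Fin m → G) : Prop :=
  ∀ t : Fin m, TendsToInfinity fun k => g k t - h k t

/-- For `α = {k₁ < ⋯ < kₘ}`, the element `g_α = g_{k₁,1} + ⋯ + g_{kₘ,m}`. The type
`Set.powersetCard ℕ m` is the family of all `m`-element subsets of `ℕ`. -/
def sumAlong {m : ℕ} (g : ℕ → Fin m → G) (α : Set.powersetCard ℕ m) : G :=
  ∑ t : Fin m, g ((α : Finset ℕ).orderEmbOfFin (Set.powersetCard.card_eq α) t) t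

end Sequences

/-- The `𝓡`-limit of a family indexed by the `m`-element subsets of `ℕ`: for every `ε > 0` there is
an `m`-element set `α₀` such that `x α` is `ε`-close to `a` whenever `min α > max α₀`. -/
def HasRLim {Y : Type*} [PseudoMetricSpace Y] {m : ℕ} (x : Set.powersetCard ℕ m → Y) (a : Y) :
    Prop :=
  ∀ ε : ℝ, 0 < ε → ∃ α₀ : Set.powersetCard ℕ m, ∀ α : Set.powersetCard ℕ m,
    (∀ i ∈ (α₀ : Finset ℕ), ∀ k ∈ (α : Finset ℕ), i < k) → dist (x α) a < ε

section Dynamics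

/-- A sequence of measure preserving maps `T k` has the mixing property if
`μ (A₀ ∩ (T k)⁻¹ A₁) → μ A₀ * μ A₁` for all measurable `A₀`, `A₁`. -/
def MixingProperty {X : Type*} [MeasurableSpace X] (μ : Measure X) (T : ℕ → X → X) : Prop :=
  ∀ A₀ A₁ : Set X, MeasurableSet A₀ → MeasurableSet A₁ →
    Tendsto (fun k => μ.real (A₀ ∩ T k ⁻¹' A₁)) atTop (𝓝 (μ.real A₀ * μ.real A₁))

/-- A measure preserving action is weakly mixing if the diagonal action on the product of the
space with itself is ergodic. -/
def IsWeaklyMixing (G : Type*) {X : Type*} [AddCommGroup G] [AddAction G X] [MeasurableSpace X]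
    (μ : Measure X) : Prop :=
  ErgodicVAdd G (X × X) (μ.prod μ)

variable {G X : Type*} [AddCommGroup G] [AddAction G X] [MeasurableSpace X]

/-- The multicorrelation `μ (A₀ ∩ T_{g₁} A₁ ∩ ⋯ ∩ T_{g_ℓ} A_ℓ)`, where `T_g A = g +ᵥ A`. -/
def multiCorrelation (μ : Measure X) {ℓ : ℕ} (A : Fin (ℓ + 1) → Set X) (g : Fin ℓ → G) : ℝ :=
  μ.real (A 0 ∩ ⋂ j : Fin ℓ, (g j +ᵥ A j.succ))

/-- The set `R_ε(A₀, …, A_ℓ)` of all `g` in `G ^ ℓ` for which the multicorrelation is `ε`-close to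
the product of the measures. -/
def mixingSet (G : Type*) [AddCommGroup G] [AddAction G X] (μ : Measure X) {ℓ : ℕ}
    (A : Fin (ℓ + 1) → Set X) (ε : ℝ) : Set (Fin ℓ → G) :=
  {g | |multiCorrelation μ A g - ∏ j, μ.real (A j)| < ε}

end Dynamics

end AbelianMixing

end

open AbelianMixing

/-
For a weakly mixing action, the averages of a multicorrelation along any Følner sequence converge to
the product of the measures, on `X` and on `X × X` alike: conditioning on one coordinate at a time,
every cluster point of the averaged measures is an invariant measure dominated by the ergodic one,
hence a multiple of it. The multicorrelations on `X × X` are the squares of those on `X`, so the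
variance of the latter tends to `0`, and they converge along a set of density one for every Følner
sequence. Separability makes joint mixing a limit along a countably generated filter, so that mixing
sequences can be extracted from this.

To find sums of `m` terms in a set `E` of positive upper density, translate the Følner sequence so
that the upper density of `E` becomes nearly the largest possible. No translate of `E` can then do
much better, so by averaging many translates are dense in a whole Følner sequence at once. A limit
`E'` of translates `E - y k` has positive upper density, and each `x ∈ E'` satisfies `x + y k ∈ E`
for all large `k`; the argument is iterated on `E'`.

Conversely, a single proper filter along which the action is mixing forces weak mixing: by a
π-λ argument mixing passes from rectangles to all measurable subsets of `X × X`, and an invariant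
set `S` then has measure `(μ × μ) S = ((μ × μ) S) ^ 2`.
-/

namespace AbelianMixing

noncomputable section

section RelDensity

open scoped BigOperators

variable {H : Type*}

/-- The relative density `|E ∩ F| / |F|` of a set `E` in a finite set `F`, so that `upperDensity`
is an upper limit of relative densities; it is `0` if `F` is empty. -/
def relDensity (F : Finset H) (E : Set H) : ℝ :=
  ((E ∩ F).ncard : ℝ) / F.card

theorem relDensity_eq_expect (F : Finset H) (E : Set H) :
    relDensity F E = 𝔼 x ∈ F, E.indicator 1 x := by
  classical
  have hE : E ∩ F = ({x ∈ F | x ∈ E} : Finset H) := by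
    ext x
    simp only [Set.mem_inter_iff, Finset.mem_coe, Finset.mem_filter, and_comm]
  rw [relDensity, hE, Set.ncard_coe_finset, Finset.expect_eq_sum_div_card, Finset.card_filter]
  simp only [Set.indicator_apply, Pi.one_apply, Nat.cast_sum, Nat.cast_ite, Nat.cast_one,
    Nat.cast_zero]

theorem relDensity_nonneg (F : Finset H) (E : Set H) : 0 ≤ relDensity F E := by
  unfold relDensity
  positivity

theorem relDensity_mono (F : Finset H) {E E' : Set H} (h : E ⊆ E') :
    relDensity F E ≤ relDensity F E' := by
  unfold relDensity
  gcongr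
  exact F.finite_toSet.inter_of_right E'

theorem relDensity_univ {F : Finset H} (hF : F.Nonempty) : relDensity F Set.univ = 1 := by
  rw [relDensity, Set.univ_inter, Set.ncard_coe_finset,
    div_self (Nat.cast_ne_zero.2 hF.card_ne_zero)]

theorem relDensity_le_one (F : Finset H) (E : Set H) : relDensity F E ≤ 1 := by
  refine div_le_one_of_le₀ ?_ (Nat.cast_nonneg _)
  rw [← Set.ncard_coe_finset F]
  exact_mod_cast Set.ncard_le_ncard Set.inter_subset_right F.finite_toSet

theorem relDensity_union_le (F : Finset H) (E E' : Set H) :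
    relDensity F (E ∪ E') ≤ relDensity F E + relDensity F E' := by
  rw [relDensity, Set.union_inter_distrib_right, relDensity, relDensity, ← add_div]
  gcongr
  exact_mod_cast Set.ncard_union_le _ _

theorem relDensity_add_compl {F : Finset H} (hF : F.Nonempty) (E : Set H) :
    relDensity F E + relDensity F Eᶜ = 1 := by
  rw [relDensity_eq_expect, relDensity_eq_expect, ← Finset.expect_add_distrib,
    ← Finset.expect_const hF (1 : ℝ)]
  exact Finset.expect_congr rfl fun x _ => congrFun (E.indicator_self_add_compl 1) x

theorem sum_relDensity_le_one {ι : Type*} {s : Finset ι} {B : ι → Set H}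
    (hB : (s : Set ι).PairwiseDisjoint B) (F : Finset H) : ∑ i ∈ s, relDensity F (B i) ≤ 1 := by
  classical
  refine le_trans (le_of_eq ?_) (relDensity_le_one F (⋃ i ∈ s, B i))
  simp only [relDensity_eq_expect, ← Finset.expect_sum_comm, Finset.indicator_biUnion s B hB]

theorem isBoundedUnder_relDensity (F : ℕ → Finset H) (E : Set H) :
    IsBoundedUnder (· ≤ ·) atTop fun k => relDensity (F k) E :=
  isBoundedUnder_of ⟨1, fun k => relDensity_le_one (F k) E⟩

theorem isCoboundedUnder_relDensity (F : ℕ → Finset H) (E : Set H) :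
    IsCoboundedUnder (· ≤ ·) atTop fun k => relDensity (F k) E :=
  isCoboundedUnder_le_of_le atTop fun k => relDensity_nonneg (F k) E

/-- The filter of sets of density one along `F`: those whose complement has relative density
tending to `0`. -/
def densityOne (F : ℕ → Finset H) : Filter H where
  sets := {S | Tendsto (fun k => relDensity (F k) Sᶜ) atTop (𝓝 0)}
  univ_sets := by
    simp only [Set.mem_ofPred_eq, Set.compl_univ, relDensity, Set.empty_inter, Set.ncard_empty,
      Nat.cast_zero, zero_div, tendsto_const_nhds_iff]
  sets_of_superset hS hST := squeeze_zero (fun k => relDensity_nonneg (F k) _)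
    (fun k => relDensity_mono (F k) (Set.compl_subset_compl.2 hST)) hS
  inter_sets {S T} hS hT := by
    have hST := hS.add hT
    rw [add_zero] at hST
    refine squeeze_zero (fun k => relDensity_nonneg (F k) _) (fun k => ?_) hST
    rw [Set.compl_inter]
    exact relDensity_union_le (F k) _ _

theorem mem_densityOne {F : ℕ → Finset H} {S : Set H} :
    S ∈ densityOne F ↔ Tendsto (fun k => relDensity (F k) Sᶜ) atTop (𝓝 0) :=
  Iff.rfl

theorem frequently_densityOne_of_upperDensity_pos {F : ℕ → Finset H} {E : Set H}
    (hE : 0 < upperDensity F E) :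
    ∃ᶠ x in densityOne F, x ∈ E := by
  intro h
  have hlim : Tendsto (fun k => relDensity (F k) E) atTop (𝓝 0) := by
    simpa only [compl_compl] using mem_densityOne.1 (show Eᶜ ∈ densityOne F from h)
  exact hE.ne' hlim.limsup_eq

theorem tendsto_densityOne_of_tendsto_expect_sq {F : ℕ → Finset H} {f : H → ℝ} {a : ℝ}
    (h : Tendsto (fun k => 𝔼 x ∈ F k, (f x - a) ^ 2) atTop (𝓝 0)) :
    Tendsto f (densityOne F) (𝓝 a) := by
  refine Metric.tendsto_nhds.2 fun ε hε => mem_densityOne.2 ?_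
  refine squeeze_zero (fun k => relDensity_nonneg _ _) (fun k => ?_)
    (by simpa only [mul_zero] using h.const_mul (ε ^ 2)⁻¹)
  -- Chebyshev's inequality
  rw [relDensity_eq_expect, Finset.mul_expect]
  refine Finset.expect_le_expect fun x _ => Set.indicator_le'
    (g := fun x => (ε ^ 2)⁻¹ * (f x - a) ^ 2) (fun x hx => ?_) (fun x _ => by positivity) x
  rw [Pi.one_apply, inv_mul_eq_div, ← sq_abs (f x - a), one_le_div (by positivity)]
  exact pow_le_pow_left₀ hε.le (not_lt.1 hx) 2

variable [AddCommGroup H]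

theorem abs_expect_add_right_sub_expect_le (F : Finset H) {f : H → ℝ} {C : ℝ}
    (hC : ∀ x, |f x| ≤ C) (h : H) :
    |𝔼 x ∈ F, f (x + h) - 𝔼 x ∈ F, f x| ≤ 2 * C * relDensity F (h +ᵥ (F : Set H))ᶜ := by
  classical
  set F' := F.map (addRightEmbedding h) with hF'
  have hshift : ∑ x ∈ F, f (x + h) = ∑ x ∈ F', f x := by
    simp only [hF', Finset.sum_map, addRightEmbedding_apply]
  have hcompl : (h +ᵥ (F : Set H))ᶜ ∩ F = (F \ F' : Finset H) := by
    ext x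
    simp only [hF', Set.mem_inter_iff, Set.mem_compl_iff, Set.mem_vadd_set, Finset.coe_sdiff,
      Set.mem_sdiff, Finset.mem_coe, Finset.mem_map, addRightEmbedding_apply, vadd_eq_add,
      add_comm h, and_comm]
  have hbound (S : Finset H) : |∑ x ∈ S, f x| ≤ S.card * C := by
    rw [← nsmul_eq_mul]
    exact (Finset.abs_sum_le_sum_abs _ _).trans (Finset.sum_le_card_nsmul _ _ C fun x _ => hC x)
  rw [Finset.expect_eq_sum_div_card, Finset.expect_eq_sum_div_card, ← sub_div, abs_div,
    Nat.abs_cast, relDensity, hcompl, Set.ncard_coe_finset, ← mul_div_assoc, hshift]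
  gcongr
  calc |∑ x ∈ F', f x - ∑ x ∈ F, f x| = |∑ x ∈ F' \ F, f x - ∑ x ∈ F \ F', f x| := by
        rw [Finset.sum_sdiff_sub_sum_sdiff]
    _ ≤ (F' \ F).card * C + (F \ F').card * C :=
        (abs_sub _ _).trans (add_le_add (hbound _) (hbound _))
    _ = 2 * C * (F \ F').card := by
        rw [Finset.card_sdiff_comm (Finset.card_map _)]
        ring

end RelDensity

section Folner

open scoped BigOperators

variable {H : Type*} [AddCommGroup H] {F : ℕ → Finset H}

theorem IsFolnerSeq.comp (hF : IsFolnerSeq F) {φ : ℕ → ℕ} (hφ : Tendsto φ atTop atTop) :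
    IsFolnerSeq (F ∘ φ) :=
  ⟨fun k => hF.1 (φ k), fun g => (hF.2 g).comp hφ⟩

theorem IsFolnerSeq.tendsto_expect_add_right_sub (hF : IsFolnerSeq F) {f : H → ℝ} {C : ℝ}
    (hC : ∀ x, |f x| ≤ C) (h : H) :
    Tendsto (fun k => 𝔼 x ∈ F k, f (x + h) - 𝔼 x ∈ F k, f x) atTop (𝓝 0) := by
  refine squeeze_zero_norm (fun k => abs_expect_add_right_sub_expect_le (F k) hC h) ?_
  have hcompl : Tendsto (fun k => 2 * C * (1 - relDensity (F k) (h +ᵥ (F k : Set H)))) atTop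
      (𝓝 (2 * C * (1 - 1))) := ((hF.2 h).const_sub 1).const_mul (2 * C)
  rw [sub_self, mul_zero] at hcompl
  exact hcompl.congr fun k => by rw [← relDensity_add_compl (hF.1 k), add_sub_cancel_left]

theorem IsFolnerSeq.tendsto_relDensity_preimage_add_right_sub (hF : IsFolnerSeq F) (E : Set H)
    (h : H) :
    Tendsto (fun k => relDensity (F k) ((· + h) ⁻¹' E) - relDensity (F k) E) atTop (𝓝 0) := by
  have hbound (x : H) : |E.indicator (1 : H → ℝ) x| ≤ 1 := by
    simpa only [Real.norm_eq_abs, Pi.one_apply, abs_one] using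
      norm_indicator_le_norm_self (s := E) (1 : H → ℝ) x
  have hcomp (x : H) : ((· + h) ⁻¹' E).indicator (1 : H → ℝ) x = E.indicator 1 (x + h) := rfl
  simpa only [relDensity_eq_expect, hcomp] using hF.tendsto_expect_add_right_sub hbound h

theorem IsFolnerSeq.upperDensity_univ (hF : IsFolnerSeq F) : upperDensity F Set.univ = 1 :=
  ((tendsto_congr fun k => relDensity_univ (hF.1 k)).2 tendsto_const_nhds).limsup_eq

theorem IsFolnerSeq.mem_densityOne_iff (hF : IsFolnerSeq F) {S : Set H} :
    S ∈ densityOne F ↔ Tendsto (fun k => relDensity (F k) S) atTop (𝓝 1) := by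
  have hcompl (k : ℕ) : 1 - relDensity (F k) Sᶜ = relDensity (F k) S := by
    rw [← relDensity_add_compl (hF.1 k) S, add_sub_cancel_right]
  rw [mem_densityOne, ← tendsto_const_sub_iff 1, sub_zero]
  simp only [hcompl]

theorem IsFolnerSeq.neBot_densityOne (hF : IsFolnerSeq F) : (densityOne F).NeBot := by
  refine neBot_iff.2 fun h => ?_
  have hempty : ∅ ∈ densityOne F := empty_mem_iff_bot.2 h
  rw [mem_densityOne, Set.compl_empty] at hempty
  simp only [relDensity_univ (hF.1 _), tendsto_const_nhds_iff, one_ne_zero] at hempty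

theorem hasUniformDensityOne_iff {E : Set H} :
    HasUniformDensityOne E ↔ ∀ F : ℕ → Finset H, IsFolnerSeq F → E ∈ densityOne F := by
  refine ⟨fun hE F hF => ?_, fun hE F hF => ((hF.mem_densityOne_iff).1 (hE F hF)).limsup_eq⟩
  refine hF.mem_densityOne_iff.2 (tendsto_of_subseq_tendsto fun ψ hψ => ?_)
  have hlim : limsup (fun k => relDensity (F (ψ k)) E) atTop = 1 := hE _ (hF.comp hψ)
  have hcluster : MapClusterPt 1 atTop fun k => relDensity (F (ψ k)) E :=
    hlim ▸ MapClusterPt.limsup (isCoboundedUnder_relDensity (F ∘ ψ) E)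
      (isBoundedUnder_relDensity (F ∘ ψ) E)
  obtain ⟨φ, hφ⟩ := hcluster.exists_seq_tendsto
  exact ⟨φ, hφ.1⟩

end Folner

section SmallSets

variable {H G : Type*} [AddCommGroup H] [AddCommGroup G] {F : ℕ → Finset H}

theorem IsFolnerSeq.compl_mem_densityOne_of_pairwise_disjoint (hF : IsFolnerSeq F) {E : Set H}
    {u : ℕ → H} (hE : Pairwise (Function.onFun Disjoint fun i => (· + u i) ⁻¹' E)) :
    Eᶜ ∈ densityOne F := by
  rw [mem_densityOne, compl_compl]
  refine tendsto_order.2 ⟨fun a ha => .of_forall fun k => ha.trans_le (relDensity_nonneg _ _),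
    fun a ha => ?_⟩
  obtain ⟨N, hN⟩ := exists_nat_gt (2 / a)
  have hNpos : (0 : ℝ) < N := (by positivity : 0 < 2 / a).trans hN
  have hshift : Tendsto (fun k => ∑ i ∈ Finset.range N,
      (relDensity (F k) ((· + u i) ⁻¹' E) - relDensity (F k) E)) atTop (𝓝 0) := by
    simpa only [Finset.sum_const_zero] using tendsto_finsetSum (Finset.range N)
      fun i _ => hF.tendsto_relDensity_preimage_add_right_sub E (u i)
  filter_upwards [hshift.eventually_const_lt (by norm_num : (-1 : ℝ) < 0)] with k hk
  have hle := sum_relDensity_le_one (s := Finset.range N) (fun i _ j _ hij => hE hij) (F k)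
  rw [Finset.sum_sub_distrib, Finset.sum_const, Finset.card_range, nsmul_eq_mul] at hk
  rw [div_lt_iff₀ ha] at hN
  exact lt_of_mul_lt_mul_left (by linarith) hNpos.le

theorem IsFolnerSeq.tendsto_densityOne_cofinite [Infinite G] (hF : IsFolnerSeq F) {φ : H →+ G}
    (hφ : Function.Surjective φ) : Tendsto φ (densityOne F) cofinite := by
  refine le_cofinite_iff_compl_singleton_mem.2 fun a => ?_
  choose u hu using fun i => hφ (Infinite.natEmbedding G i)
  refine hF.compl_mem_densityOne_of_pairwise_disjoint (E := φ ⁻¹' {a}) (u := u) fun i j hij => ?_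
  refine Set.disjoint_left.2 fun x hi hj => hij ((Infinite.natEmbedding G).injective ?_)
  simp only [Set.mem_preimage, Set.mem_singleton_iff, map_add, hu] at hi hj
  exact add_left_cancel (hi.trans hj.symm)

end SmallSets

section Existence

variable {H : Type*} [AddCommGroup H]

theorem one_sub_le_relDensity_vadd {F F' : Finset H} (hF : F.Nonempty) (hF' : F ⊆ F') {h : H}
    (hh : ∀ x ∈ F, h + x ∈ F') {ε : ℝ} (hcard : (F'.card : ℝ) ≤ (1 + ε) * F.card) :
    1 - ε ≤ relDensity F (h +ᵥ (F : Set H)) := by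
  classical
  set S := F.map (addLeftEmbedding h) with hS
  have hinter : (h +ᵥ (F : Set H)) ∩ F = (S ∩ F : Finset H) := by
    ext x
    simp only [hS, Set.mem_inter_iff, Set.mem_vadd_set, Finset.mem_coe, Finset.mem_inter,
      Finset.mem_map, addLeftEmbedding_apply, vadd_eq_add]
  have hunion : S ∪ F ⊆ F' := by
    refine Finset.union_subset (fun x hx => ?_) hF'
    obtain ⟨y, hy, rfl⟩ := Finset.mem_map.1 hx
    exact hh y hy
  have hle : ((S ∪ F).card : ℝ) ≤ F'.card := by exact_mod_cast Finset.card_le_card hunion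
  have hcards : ((S ∪ F).card : ℝ) + (S ∩ F).card = F.card + F.card := by
    exact_mod_cast (Finset.card_union_add_card_inter S F).trans (by rw [Finset.card_map])
  rw [relDensity, hinter, Set.ncard_coe_finset, le_div_iff₀ (by exact_mod_cast hF.card_pos)]
  linarith

open Classical in
/-- The box of all sums `∑ i < k, n i • e i` with `0 ≤ n i < N`, the building block of a Følner
sequence: adding `e i` to such a sum increases a single coefficient by one. -/
def boxSums (e : ℕ → H) (k N : ℕ) : Finset H :=
  (Fintype.piFinset fun _ : Fin k => Finset.range N).image fun n => ∑ i : Fin k, n i • e i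

theorem mem_boxSums {e : ℕ → H} {k N : ℕ} {x : H} :
    x ∈ boxSums e k N ↔ ∃ n : Fin k → ℕ, (∀ i, n i < N) ∧ ∑ i, n i • e i = x := by
  simp only [boxSums, Finset.mem_image, Fintype.mem_piFinset, Finset.mem_range]

theorem boxSums_nonempty (e : ℕ → H) (k N : ℕ) : (boxSums e k (N + 1)).Nonempty :=
  ⟨_, mem_boxSums.2 ⟨0, fun _ => N.succ_pos, rfl⟩⟩

theorem boxSums_mono (e : ℕ → H) (k : ℕ) : Monotone (boxSums e k) := by
  intro N M h x hx
  obtain ⟨n, hn, rfl⟩ := mem_boxSums.1 hx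
  exact mem_boxSums.2 ⟨n, fun i => (hn i).trans_le h, rfl⟩

theorem card_boxSums_le (e : ℕ → H) (k N : ℕ) : (boxSums e k N).card ≤ N ^ k := by
  classical
  refine Finset.card_image_le.trans_eq ?_
  rw [Fintype.card_piFinset_const, Finset.card_range]

theorem add_mem_boxSums {e : ℕ → H} {k N i : ℕ} (hi : i < k) {x : H} (hx : x ∈ boxSums e k N) :
    e i + x ∈ boxSums e k (N + 1) := by
  obtain ⟨n, hn, rfl⟩ := mem_boxSums.1 hx
  refine mem_boxSums.2 ⟨Pi.single ⟨i, hi⟩ 1 + n, fun j => ?_, ?_⟩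
  · have hsingle : (Pi.single ⟨i, hi⟩ 1 : Fin k → ℕ) j ≤ 1 := by
      rw [Pi.single_apply]
      split_ifs <;> simp
    have hj := hn j
    rw [Pi.add_apply]
    omega
  · simp only [Pi.add_apply, add_smul, Finset.sum_add_distrib, Pi.single_apply, ite_smul, one_smul,
      zero_smul, Finset.sum_ite_eq', Finset.mem_univ, if_true]

theorem exists_card_boxSums_le (e : ℕ → H) (k : ℕ) {ε : ℝ} (hε : 0 < ε) :
    ∃ N, ((boxSums e k (N + 2)).card : ℝ) ≤ (1 + ε) * (boxSums e k (N + 1)).card := by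
  by_contra! hcon
  have hgrowth (N : ℕ) : (1 + ε) ^ N ≤ ((boxSums e k (N + 1)).card : ℝ) := by
    induction N with
    | zero =>
      rw [pow_zero]
      exact_mod_cast (boxSums_nonempty e k 0).card_pos
    | succ N ih =>
      rw [pow_succ']
      exact (mul_le_mul_of_nonneg_left ih (by positivity)).trans (hcon N).le
  -- exponential growth contradicts the polynomial bound `card_boxSums_le`
  obtain ⟨N, hN⟩ := (((tendsto_pow_const_div_const_pow_of_one_lt k (by linarith : 1 < 1 + ε)).comp
    (tendsto_add_atTop_nat 1)).eventually_lt_const (by positivity : 0 < (1 + ε)⁻¹)).exists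
  rw [Function.comp_apply, div_lt_iff₀ (by positivity), pow_succ',
    inv_mul_cancel_left₀ (by positivity)] at hN
  exact (hN.trans_le (hgrowth N)).not_ge (by exact_mod_cast card_boxSums_le e k (N + 1))

theorem exists_isFolnerSeq (H : Type*) [AddCommGroup H] [Countable H] :
    ∃ F : ℕ → Finset H, IsFolnerSeq F := by
  obtain ⟨e, he⟩ := exists_surjective_nat H
  choose N hN using fun k : ℕ => exists_card_boxSums_le e k (ε := 1 / ((k : ℝ) + 1)) (by positivity)
  refine ⟨fun k => boxSums e k (N k + 1), fun k => boxSums_nonempty e k _, fun g => ?_⟩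
  obtain ⟨i, rfl⟩ := he g
  have hlower : Tendsto (fun k : ℕ => 1 - 1 / ((k : ℝ) + 1)) atTop (𝓝 1) := by
    simpa only [sub_zero] using tendsto_one_div_add_atTop_nhds_zero_nat.const_sub (1 : ℝ)
  refine tendsto_of_tendsto_of_tendsto_of_le_of_le' hlower tendsto_const_nhds ?_
    (.of_forall fun k => relDensity_le_one _ _)
  filter_upwards [eventually_gt_atTop i] with k hk
  exact one_sub_le_relDensity_vadd (boxSums_nonempty e k _) (boxSums_mono e k (Nat.le_succ _))
    (fun x hx => add_mem_boxSums hk hx) (hN k)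

end Existence

section Ergodic

open scoped BigOperators ENNReal

variable {G Y : Type*} [AddCommGroup G] [MeasurableSpace Y] {ν : Measure Y}

theorem isSetRing_measurableSet (Y : Type*) [MeasurableSpace Y] :
    IsSetRing {s : Set Y | MeasurableSet s} :=
  ⟨.empty, fun _ _ hs ht => hs.union ht, fun _ _ hs ht => hs.diff ht⟩

theorem exists_measure_eq_of_addContent_le [IsFiniteMeasure ν]
    (m : AddContent ℝ≥0∞ {s : Set Y | MeasurableSet s}) (hm : ∀ s, MeasurableSet s → m s ≤ ν s) :
    ∃ ρ : Measure Y, ρ ≤ ν ∧ ∀ s, MeasurableSet s → ρ s = m s := by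
  let ρ : Measure Y := .ofMeasurable (fun s _ => m s) addContent_empty fun f hf hd =>
    addContent_iUnion_eq_sum_of_tendsto_zero (isSetRing_measurableSet Y) m
      (fun s hs => ((hm s hs).trans_lt (measure_lt_top ν s)).ne)
      (fun s hs hanti hempty => by
        have hlim := tendsto_measure_iInter_atTop (fun n => (hs n).nullMeasurableSet) hanti
          ⟨0, measure_ne_top ν (s 0)⟩
        rw [hempty, measure_empty] at hlim
        exact tendsto_of_tendsto_of_tendsto_of_le_of_le tendsto_const_nhds hlim
          (fun _ => zero_le) fun n => hm _ (hs n))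
      hf (.iUnion hf) hd
  have hρ (s : Set Y) (hs : MeasurableSet s) : ρ s = m s := Measure.ofMeasurable_apply s hs
  exact ⟨ρ, Measure.le_iff.2 fun s hs => (hρ s hs).trans_le (hm s hs), hρ⟩

variable [AddAction G Y] [MeasurableConstVAdd G Y]

theorem exists_eq_smul_of_ergodicVAdd [IsFiniteMeasure ν] [ErgodicVAdd G Y ν] {ρ : Measure Y}
    [IsFiniteMeasure ρ] (hρ : ∀ g : G, MeasurePreserving (g +ᵥ · : Y → Y) ρ ρ) (hac : ρ ≪ ν) :
    ∃ c : ℝ≥0∞, ρ = c • ν := by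
  obtain ⟨c, hc⟩ : ∃ c, ρ.rnDeriv ν =ᵐ[ν] Function.const Y c := by
    refine exists_eventuallyEq_const_of_forall_separating MeasurableSet fun U hU => ?_
    refine eventuallyConst_set.1 (aeconst_of_forall_preimage_vadd_ae_eq G
      (s := ρ.rnDeriv ν ⁻¹' U) (Measure.measurable_rnDeriv ρ ν hU).nullMeasurableSet fun g => ?_)
    have hinv := (hρ g).rnDeriv_comp_aeEq (measurePreserving_vadd g ν)
    rw [← Set.preimage_comp]
    exact (hinv.mono fun x hx => by rw [Set.mem_preimage, Set.mem_preimage, ← hx]).set_eq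
  refine ⟨c, ?_⟩
  rw [← Measure.withDensity_rnDeriv_eq ρ ν hac, withDensity_congr_ae hc]
  exact withDensity_const c

theorem addContent_eq_mul_of_ergodicVAdd [IsProbabilityMeasure ν] [ErgodicVAdd G Y ν]
    {m : AddContent ℝ≥0∞ {s : Set Y | MeasurableSet s}} (hm : ∀ s, MeasurableSet s → m s ≤ ν s)
    (hinv : ∀ (g : G) s, MeasurableSet s → m (g +ᵥ s) = m s) {s : Set Y} (hs : MeasurableSet s) :
    m s = m Set.univ * ν s := by
  obtain ⟨ρ, hρν, hρ⟩ := exists_measure_eq_of_addContent_le m hm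
  have hfinite : IsFiniteMeasure ρ := ⟨(hρν _).trans_lt (measure_lt_top ν _)⟩
  have hpres (g : G) : MeasurePreserving (g +ᵥ · : Y → Y) ρ ρ := by
    refine ⟨measurable_const_vadd g, Measure.ext fun t ht => ?_⟩
    rw [Measure.map_apply (measurable_const_vadd g) ht, Set.preimage_vadd,
      hρ _ (ht.const_vadd (-g)), hρ t ht, hinv (-g) t ht]
  obtain ⟨c, hc⟩ := exists_eq_smul_of_ergodicVAdd hpres (Measure.absolutelyContinuous_of_le hρν)
  simp only [← hρ s hs, ← hρ _ .univ, hc, Measure.smul_apply, smul_eq_mul, measure_univ, mul_one]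

theorem tendsto_measureReal_of_ergodicVAdd [IsProbabilityMeasure ν] [ErgodicVAdd G Y ν] {ι : Type*}
    {l : Filter ι} {κ : ι → Measure Y} (hκ : ∀ i, κ i ≤ ν)
    (hinv : ∀ (g : G) s, MeasurableSet s →
      Tendsto (fun i => (κ i).real (g +ᵥ s) - (κ i).real s) l (𝓝 0))
    {c : ℝ} (hc : Tendsto (fun i => (κ i).real Set.univ) l (𝓝 c)) {s : Set Y}
    (hs : MeasurableSet s) : Tendsto (fun i => (κ i).real s) l (𝓝 (c * ν.real s)) := by
  refine (tendsto_iff_ultrafilter _ _ _).2 fun U hU => ?_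
  let L (s : Set Y) : ℝ≥0∞ := (U.map fun i => κ i s).lim
  have hL (s : Set Y) : Tendsto (fun i => κ i s) U (𝓝 (L s)) := Ultrafilter.le_nhds_lim _
  have hLν (s : Set Y) : L s ≤ ν s := le_of_tendsto' (hL s) fun i => hκ i s
  have hLtop (s : Set Y) : L s ≠ ∞ := ((hLν s).trans_lt (measure_lt_top ν s)).ne
  have hLreal (s : Set Y) : Tendsto (fun i => (κ i).real s) U (𝓝 (L s).toReal) :=
    (ENNReal.tendsto_toReal (hLtop s)).comp (hL s)
  let m : AddContent ℝ≥0∞ {s : Set Y | MeasurableSet s} :=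
    (isSetRing_measurableSet Y).addContent_of_union L
      (le_antisymm ((hLν ∅).trans_eq measure_empty) zero_le)
      fun {s t} _ ht hd => tendsto_nhds_unique (hL (s ∪ t))
        (((hL s).add (hL t)).congr fun i => (measure_union hd ht).symm)
  have hminv (g : G) (s : Set Y) (hs : MeasurableSet s) : m (g +ᵥ s) = m s :=
    (ENNReal.toReal_eq_toReal_iff' (hLtop _) (hLtop _)).1 <| sub_eq_zero.1 <|
      tendsto_nhds_unique ((hLreal _).sub (hLreal s)) ((hinv g s hs).mono_left hU)
  have hLs : L s = L Set.univ * ν s :=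
    addContent_eq_mul_of_ergodicVAdd (m := m) (fun s _ => hLν s) hminv hs
  have hLuniv : (L Set.univ).toReal = c := tendsto_nhds_unique (hLreal _) (hc.mono_left hU)
  rw [← hLuniv, measureReal_def ν, ← ENNReal.toReal_mul, ← hLs]
  exact hLreal s

theorem exists_measure_real_eq_expect [IsFiniteMeasure ν] [VAddInvariantMeasure G Y ν] {H : Type*}
    (F : Finset H) (φ : H → G) (C : H → Set Y) :
    ∃ κ : Measure Y, κ ≤ ν ∧
      ∀ A, MeasurableSet A → κ.real A = 𝔼 x ∈ F, ν.real (C x ∩ (φ x +ᵥ A)) := by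
  have hmap (A : Set Y) (hA : MeasurableSet A) (x : H) :
      (ν.restrict (C x)).map (-φ x +ᵥ ·) A = ν (C x ∩ (φ x +ᵥ A)) := by
    rw [Measure.map_apply (measurable_const_vadd _) hA, Set.preimage_vadd, neg_neg,
      Measure.restrict_apply (hA.const_vadd _), Set.inter_comm]
  have hκ (A : Set Y) (hA : MeasurableSet A) :
      ((F.card : ℝ≥0∞)⁻¹ • ∑ x ∈ F, (ν.restrict (C x)).map (-φ x +ᵥ ·)) A =
        (∑ x ∈ F, ν (C x ∩ (φ x +ᵥ A))) / F.card := by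
    simp only [Measure.smul_apply, Measure.finsetSum_apply, smul_eq_mul, hmap A hA,
      ENNReal.div_eq_inv_mul]
  refine ⟨_, Measure.le_iff.2 fun A hA => (hκ A hA).trans_le ?_, fun A hA => ?_⟩
  · refine ENNReal.div_le_of_le_mul' ?_
    rw [← nsmul_eq_mul]
    exact Finset.sum_le_card_nsmul _ _ _ fun x _ =>
      (measure_mono Set.inter_subset_right).trans_eq (measure_vadd _ _ _)
  · rw [measureReal_def, hκ A hA, ENNReal.toReal_div, ENNReal.toReal_natCast,
      ENNReal.toReal_sum fun x _ => measure_ne_top ν _, Finset.expect_eq_sum_div_card]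
    rfl

end Ergodic

section MulticorrelationAverages

open scoped BigOperators

variable {G Y H : Type*} [AddCommGroup G] [MeasurableSpace Y] [AddAction G Y]
  [MeasurableConstVAdd G Y] {ν : Measure Y} [IsProbabilityMeasure ν] [ErgodicVAdd G Y ν]
  [AddCommGroup H] {F : ℕ → Finset H}

theorem IsFolnerSeq.tendsto_expect_measureReal_inter_vadd (hF : IsFolnerSeq F) {φ : H →+ G}
    {C : H → Set Y} (hC : ∀ g, ∃ u, φ u = g ∧ ∀ x, C (x + u) = C x) {c : ℝ}
    (hc : Tendsto (fun k => 𝔼 x ∈ F k, ν.real (C x)) atTop (𝓝 c)) {A : Set Y}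
    (hA : MeasurableSet A) :
    Tendsto (fun k => 𝔼 x ∈ F k, ν.real (C x ∩ (φ x +ᵥ A))) atTop (𝓝 (c * ν.real A)) := by
  choose κ hκν hκ using fun k => exists_measure_real_eq_expect (ν := ν) (F k) φ C
  have hinv (g : G) (s : Set Y) (hs : MeasurableSet s) :
      Tendsto (fun k => (κ k).real (g +ᵥ s) - (κ k).real s) atTop (𝓝 0) := by
    obtain ⟨u, hu, hCu⟩ := hC g
    have hshift := hF.tendsto_expect_add_right_sub (f := fun x => ν.real (C x ∩ (φ x +ᵥ s)))
      (fun x => (abs_of_nonneg measureReal_nonneg).trans_le measureReal_le_one) u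
    simpa only [hκ _ _ (hs.const_vadd g), hκ _ s hs, map_add, hu, hCu, add_vadd] using hshift
  have hκuniv : Tendsto (fun k => (κ k).real Set.univ) atTop (𝓝 c) := by
    simpa only [hκ _ _ .univ, Set.vadd_set_univ, Set.inter_univ] using hc
  simpa only [hκ _ A hA] using tendsto_measureReal_of_ergodicVAdd hκν hinv hκuniv hA

theorem IsFolnerSeq.tendsto_expect_multiCorrelation (hF : IsFolnerSeq F) {n : ℕ}
    {Φ : H →+ (Fin n → G)} (hΦ : Function.Surjective Φ) {A : Fin (n + 1) → Set Y}
    (hA : ∀ j, MeasurableSet (A j)) :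
    Tendsto (fun k => 𝔼 x ∈ F k, multiCorrelation ν A (Φ x)) atTop (𝓝 (∏ j, ν.real (A j))) := by
  classical
  have hpartial (s : Finset (Fin n)) :
      Tendsto (fun k => 𝔼 x ∈ F k, ν.real (A 0 ∩ ⋂ j ∈ s, (Φ x j +ᵥ A j.succ))) atTop
        (𝓝 (ν.real (A 0) * ∏ j ∈ s, ν.real (A j.succ))) := by
    induction s using Finset.induction_on with
    | empty =>
      simp only [Finset.notMem_empty, Set.iInter_of_empty, Set.iInter_univ, Set.inter_univ,
        Finset.prod_empty, mul_one, Finset.expect_const (hF.1 _), tendsto_const_nhds_iff]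
    | insert i s hi ih =>
      have hadd := hF.tendsto_expect_measureReal_inter_vadd
        (φ := (Pi.evalAddMonoidHom (fun _ => G) i).comp Φ)
        (C := fun x => A 0 ∩ ⋂ j ∈ s, (Φ x j +ᵥ A j.succ)) (fun g => ?_) ih (hA i.succ)
      · simp only [Finset.prod_insert hi, Finset.set_biInter_insert,
          mul_left_comm (ν.real (A 0)), Set.inter_left_comm (A 0)]
        simpa only [mul_comm, Set.inter_comm, AddMonoidHom.comp_apply,
          Pi.evalAddMonoidHom_apply] using hadd
      · obtain ⟨u, hu⟩ := hΦ (Pi.single i g)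
        refine ⟨u, by simp [hu], fun x => congrArg (A 0 ∩ ·) (Set.iInter₂_congr fun j hj => ?_)⟩
        rw [map_add, hu, Pi.add_apply, Pi.single_eq_of_ne (ne_of_mem_of_not_mem hj hi), add_zero]
  simpa only [multiCorrelation, Finset.mem_univ, Set.iInter_true,
    ← Fin.prod_univ_succ fun j => ν.real (A j)] using hpartial Finset.univ

end MulticorrelationAverages

section MixingFilters

variable {G X : Type*} [AddCommGroup G] [AddAction G X] [MeasurableSpace X] {μ : Measure X}

theorem measureReal_vadd_set [MeasurableConstVAdd G X] [VAddInvariantMeasure G X μ] (g : G)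
    (A : Set X) : μ.real (g +ᵥ A) = μ.real A :=
  congrArg ENNReal.toReal (measure_vadd μ g A)

theorem measureReal_inter_neg_vadd_set [MeasurableConstVAdd G X] [VAddInvariantMeasure G X μ]
    (g : G) (A B : Set X) : μ.real (A ∩ (-g +ᵥ B)) = μ.real (B ∩ (g +ᵥ A)) := by
  rw [← measureReal_vadd_set g (A ∩ _), Set.vadd_set_inter, vadd_neg_vadd, Set.inter_comm]

/-- The filter of joint mixing on `G ^ n`: the coarsest filter along which the multicorrelations of
any measurable sets tend to the product of the measures of these sets. -/
def multiMixingFilter (G : Type*) [AddCommGroup G] [AddAction G X] (μ : Measure X) (n : ℕ) :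
    Filter (Fin n → G) :=
  ⨅ (A : Fin (n + 1) → Set X) (_ : ∀ j, MeasurableSet (A j)),
    comap (multiCorrelation μ A) (𝓝 (∏ j, μ.real (A j)))

/-- The filter of mixing on `G`, the case of a single group element of `multiMixingFilter`. -/
def mixingFilter (G : Type*) [AddCommGroup G] [AddAction G X] (μ : Measure X) : Filter G :=
  comap (fun g _ => g) (multiMixingFilter G μ 1)

variable {ι : Type*} {l : Filter ι} {n : ℕ}

theorem tendsto_multiMixingFilter_iff {γ : ι → Fin n → G} :
    Tendsto γ l (multiMixingFilter G μ n) ↔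
      ∀ A : Fin (n + 1) → Set X, (∀ j, MeasurableSet (A j)) →
        Tendsto (fun i => multiCorrelation μ A (γ i)) l (𝓝 (∏ j, μ.real (A j))) := by
  simp only [multiMixingFilter, tendsto_iInf, tendsto_comap_iff, Function.comp_def]

theorem tendsto_mixingFilter_iff {γ : ι → G} :
    Tendsto γ l (mixingFilter G μ) ↔
      ∀ A B : Set X, MeasurableSet A → MeasurableSet B →
        Tendsto (fun i => μ.real (A ∩ (γ i +ᵥ B))) l (𝓝 (μ.real A * μ.real B)) := by
  rw [mixingFilter, tendsto_comap_iff, tendsto_multiMixingFilter_iff]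
  have hcorr (A : Fin (1 + 1) → Set X) (g : G) :
      multiCorrelation μ A (fun _ => g) = μ.real (A 0 ∩ (g +ᵥ A 1)) :=
    congrArg (fun B => μ.real (A 0 ∩ B)) (iInf_unique (f := fun j : Fin 1 => g +ᵥ A j.succ))
  have hprod (A : Fin (1 + 1) → Set X) : ∏ j, μ.real (A j) = μ.real (A 0) * μ.real (A 1) :=
    Fin.prod_univ_two _
  simp only [Function.comp_def, hcorr, hprod]
  exact ⟨fun h A B hA hB => h ![A, B] (Fin.forall_fin_two.2 ⟨hA, hB⟩),
    fun h A hA => h (A 0) (A 1) (hA 0) (hA 1)⟩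

theorem mixingProperty_iff [MeasurableConstVAdd G X] [VAddInvariantMeasure G X μ] {γ : ℕ → G} :
    MixingProperty μ (fun k (x : X) => γ k +ᵥ x) ↔ Tendsto γ atTop (mixingFilter G μ) := by
  rw [tendsto_mixingFilter_iff]
  simp only [MixingProperty, Set.preimage_vadd, measureReal_inter_neg_vadd_set]
  exact ⟨fun h A B hA hB => mul_comm (μ.real B) _ ▸ h B A hB hA,
    fun h A B hA hB => mul_comm (μ.real B) _ ▸ h B A hB hA⟩

theorem tendsto_apply_multiMixingFilter [IsProbabilityMeasure μ] (j : Fin n) :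
    Tendsto (fun g => g j) (multiMixingFilter G μ n) (mixingFilter G μ) := by
  refine tendsto_mixingFilter_iff.2 fun A B hA hB => ?_
  let C : Fin (n + 1) → Set X := Fin.cons A (Function.update (fun _ => Set.univ) j B)
  have hC : ∀ i, MeasurableSet (C i) := by
    refine Fin.cases hA fun i => ?_
    rcases eq_or_ne i j with rfl | hij
    · simpa [C] using hB
    · simp [C, hij]
  have hprod : ∏ i, μ.real (C i) = μ.real A * μ.real B := by
    rw [Fin.prod_univ_succ, Finset.prod_eq_single j (fun i _ hij => by simp [C, hij]) (by simp)]
    simp only [C, Fin.cons_zero, Fin.cons_succ, Function.update_self]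
  have hcorr (g : Fin n → G) : multiCorrelation μ C g = μ.real (A ∩ (g j +ᵥ B)) := by
    have hinter : ⋂ i, (g i +ᵥ C i.succ) = g j +ᵥ B := by
      refine (Set.iInter_subset_of_subset j (by simp [C])).antisymm (Set.subset_iInter fun i => ?_)
      rcases eq_or_ne i j with rfl | hij
      · simp [C]
      · simp [C, hij]
    rw [multiCorrelation, hinter]
    rfl
  simpa only [hprod, hcorr, id_eq] using
    tendsto_multiMixingFilter_iff.1 (tendsto_id (x := multiMixingFilter G μ n)) C hC

section Separable

variable [MeasurableConstVAdd G X] [VAddInvariantMeasure G X μ] [IsFiniteMeasure μ]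

theorem abs_multiCorrelation_sub_le {A B : Fin (n + 1) → Set X}
    (hA : ∀ j, MeasurableSet (A j)) (hB : ∀ j, MeasurableSet (B j)) (g : Fin n → G) :
    |multiCorrelation μ A g - multiCorrelation μ B g| ≤ ∑ j, μ.real (symmDiff (A j) (B j)) := by
  have hmeas {A : Fin (n + 1) → Set X} (hA : ∀ j, MeasurableSet (A j)) :
      MeasurableSet (A 0 ∩ ⋂ j : Fin n, (g j +ᵥ A j.succ)) :=
    (hA 0).inter (.iInter fun j => (hA j.succ).const_vadd _)
  have hsub : symmDiff (A 0 ∩ ⋂ j : Fin n, (g j +ᵥ A j.succ))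
        (B 0 ∩ ⋂ j : Fin n, (g j +ᵥ B j.succ)) ⊆
      symmDiff (A 0) (B 0) ∪ ⋃ j : Fin n, (g j +ᵥ symmDiff (A j.succ) (B j.succ)) := by
    intro x
    simp only [Set.mem_union, Set.mem_iUnion, Set.mem_symmDiff, Set.mem_inter_iff, Set.mem_iInter,
      Set.mem_vadd_set_iff_neg_vadd_mem]
    grind
  calc |multiCorrelation μ A g - multiCorrelation μ B g|
      ≤ μ.real (symmDiff (A 0 ∩ ⋂ j : Fin n, (g j +ᵥ A j.succ))
          (B 0 ∩ ⋂ j : Fin n, (g j +ᵥ B j.succ))) :=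
        abs_measureReal_sub_le_measureReal_symmDiff (hmeas hA).nullMeasurableSet
          (hmeas hB).nullMeasurableSet
    _ ≤ μ.real (symmDiff (A 0) (B 0)) +
          ∑ j : Fin n, μ.real (g j +ᵥ symmDiff (A j.succ) (B j.succ)) :=
        (measureReal_mono hsub).trans <| (measureReal_union_le _ _).trans <| by
          gcongr
          exact measureReal_iUnion_fintype_le _
    _ = ∑ j, μ.real (symmDiff (A j) (B j)) := by
        simp only [measureReal_vadd_set, Fin.sum_univ_succ fun j => μ.real (symmDiff (A j) (B j))]

theorem tendsto_multiCorrelation_of_measureDense {𝒜 : Set (Set X)} (h𝒜 : μ.MeasureDense 𝒜)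
    {γ : ι → Fin n → G}
    (hγ : ∀ A : Fin (n + 1) → Set X, (∀ j, A j ∈ 𝒜) →
      Tendsto (fun i => multiCorrelation μ A (γ i)) l (𝓝 (∏ j, μ.real (A j))))
    {A : Fin (n + 1) → Set X} (hA : ∀ j, MeasurableSet (A j)) :
    Tendsto (fun i => multiCorrelation μ A (γ i)) l (𝓝 (∏ j, μ.real (A j))) := by
  have happrox (N : ℕ) (j : Fin (n + 1)) :
      ∃ B ∈ 𝒜, μ.real (symmDiff (A j) B) ≤ 1 / ((N : ℝ) + 1) := by
    obtain ⟨B, hB, hlt⟩ := h𝒜.approx (A j) (hA j) (measure_ne_top μ _) (1 / ((N : ℝ) + 1))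
      (by positivity)
    exact ⟨B, hB, ENNReal.toReal_le_of_le_ofReal (by positivity) hlt.le⟩
  choose B hB𝒜 hB using happrox
  have hBmeas (N : ℕ) (j : Fin (n + 1)) : MeasurableSet (B N j) := h𝒜.measurable _ (hB𝒜 N j)
  have hzero := tendsto_one_div_add_atTop_nhds_zero_nat (𝕜 := ℝ)
  refine TendstoUniformlyOnFilter.tendsto_of_eventually_tendsto (p := atTop)
    (F := fun N i => multiCorrelation μ (B N) (γ i)) (L := fun N => ∏ j, μ.real (B N j)) ?_
    (.of_forall fun N => hγ (B N) (hB𝒜 N)) (tendsto_finsetProd _ fun j _ => ?_)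
  · refine Metric.tendstoUniformlyOnFilter_iff.2 fun ε hε => ?_
    have hsum : Tendsto (fun N : ℕ => ∑ _j : Fin (n + 1), 1 / ((N : ℝ) + 1)) atTop (𝓝 0) := by
      simpa only [Finset.sum_const_zero] using
        tendsto_finsetSum (Finset.univ : Finset (Fin (n + 1))) fun _ _ => hzero
    refine ((hsum.eventually (gt_mem_nhds hε)).prod_inl l).mono fun x hx => ?_
    exact (abs_multiCorrelation_sub_le hA (hBmeas x.1) (γ x.2)).trans_lt
      ((Finset.sum_le_sum fun j _ => hB x.1 j).trans_lt hx)
  · refine tendsto_iff_dist_tendsto_zero.2 (squeeze_zero (fun _ => dist_nonneg) (fun N => ?_) hzero)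
    rw [dist_comm, Real.dist_eq]
    exact (abs_measureReal_sub_le_measureReal_symmDiff (hA j).nullMeasurableSet
      (hBmeas N j).nullMeasurableSet).trans (hB N j)

theorem isCountablyGenerated_multiMixingFilter (G : Type*) [AddCommGroup G] [AddAction G X]
    [MeasurableConstVAdd G X] [VAddInvariantMeasure G X μ] [IsSeparable μ] (n : ℕ) :
    (multiMixingFilter G μ n).IsCountablyGenerated := by
  obtain ⟨𝒜, h𝒜c, h𝒜⟩ := exists_countable_measureDense μ
  have := h𝒜c.to_subtype
  have heq : multiMixingFilter G μ n = ⨅ A : Fin (n + 1) → 𝒜,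
      comap (multiCorrelation μ fun j => (A j : Set X)) (𝓝 (∏ j, μ.real (A j : Set X))) := by
    refine le_antisymm (le_iInf fun A => iInf₂_le _ fun j => h𝒜.measurable _ (A j).2) ?_
    refine le_iInf₂ fun A hA => tendsto_iff_comap.1 ?_
    refine tendsto_multiCorrelation_of_measureDense h𝒜 (γ := id) (fun B hB => ?_) hA
    exact tendsto_iff_comap.2 (iInf_le _ fun j => (⟨B j, hB j⟩ : 𝒜))
  rw [heq]
  infer_instance

theorem isCountablyGenerated_mixingFilter (G : Type*) [AddCommGroup G] [AddAction G X]
    [MeasurableConstVAdd G X] [VAddInvariantMeasure G X μ] [IsSeparable μ] :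
    (mixingFilter G μ).IsCountablyGenerated := by
  have := isCountablyGenerated_multiMixingFilter (μ := μ) G 1
  unfold mixingFilter
  infer_instance

end Separable

end MixingFilters

section WeakMixing

open scoped BigOperators

variable {G X : Type*} [AddCommGroup G] [AddAction G X] [MeasurableSpace X] {μ : Measure X}

theorem multiCorrelation_prod_self [SFinite μ] {n : ℕ} (A : Fin (n + 1) → Set X) (g : Fin n → G) :
    multiCorrelation (μ.prod μ) (fun j => A j ×ˢ A j) g = multiCorrelation μ A g ^ 2 := by
  have hinter : (A 0 ×ˢ A 0) ∩ ⋂ j : Fin n, (g j +ᵥ (A j.succ ×ˢ A j.succ)) =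
      (A 0 ∩ ⋂ j : Fin n, (g j +ᵥ A j.succ)) ×ˢ (A 0 ∩ ⋂ j : Fin n, (g j +ᵥ A j.succ)) := by
    ext x
    simp only [Set.vadd_set_prod, Set.mem_inter_iff, Set.mem_prod, Set.mem_iInter]
    grind
  rw [multiCorrelation, hinter, measureReal_prod_prod, ← pow_two, multiCorrelation]

variable [IsProbabilityMeasure μ]

theorem IsWeaklyMixing.ergodicVAdd [VAddInvariantMeasure G X μ] (h : IsWeaklyMixing G μ) :
    ErgodicVAdd G X μ where
  aeconst_of_forall_preimage_vadd_ae_eq {s} hs hinv := by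
    have hprod : ErgodicVAdd G (X × X) (μ.prod μ) := h
    have hfst : MeasurePreserving (Prod.fst : X × X → X) (μ.prod μ) μ := measurePreserving_fst
    exact (hfst.aeconst_preimage hs.nullMeasurableSet).1 <|
      hprod.aeconst_of_forall_preimage_vadd_ae_eq (s := Prod.fst ⁻¹' s) (measurable_fst hs)
        fun g => hfst.quasiMeasurePreserving.preimage_ae_eq (hinv g)

variable [MeasurableConstVAdd G X]

instance measurableConstVAdd_prod : MeasurableConstVAdd G (X × X) where
  measurable_const_vadd g := ((measurable_const_vadd g).comp measurable_fst).prodMk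
    ((measurable_const_vadd g).comp measurable_snd)

variable [VAddInvariantMeasure G X μ] {H : Type*} [AddCommGroup H] {F : ℕ → Finset H}

theorem IsWeaklyMixing.tendsto_multiMixingFilter (h : IsWeaklyMixing G μ) (hF : IsFolnerSeq F)
    {n : ℕ} {Φ : H →+ (Fin n → G)} (hΦ : Function.Surjective Φ) :
    Tendsto Φ (densityOne F) (multiMixingFilter G μ n) := by
  refine tendsto_multiMixingFilter_iff.2 fun A hA => ?_
  have hX : ErgodicVAdd G X μ := h.ergodicVAdd
  have hXX : ErgodicVAdd G (X × X) (μ.prod μ) := h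
  set p := ∏ j, μ.real (A j) with hp
  have hmean := hF.tendsto_expect_multiCorrelation (ν := μ) hΦ hA
  have hsq := hF.tendsto_expect_multiCorrelation (ν := μ.prod μ) hΦ fun j => (hA j).prod (hA j)
  simp only [multiCorrelation_prod_self, measureReal_prod_prod, Finset.prod_mul_distrib,
    ← hp] at hmean hsq
  -- the variance of the multicorrelations along `F` tends to `p ^ 2 - p ^ 2 = 0`
  have hvar := (hsq.sub (hmean.const_mul (2 * p))).add_const (p * p)
  refine tendsto_densityOne_of_tendsto_expect_sq ?_
  convert hvar using 2 with k
  · rw [← Finset.expect_const (hF.1 k) (p * p), Finset.mul_expect, ← Finset.expect_sub_distrib,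
      ← Finset.expect_add_distrib]
    exact Finset.expect_congr rfl fun x _ => by ring
  · ring

theorem IsWeaklyMixing.tendsto_mixingFilter (h : IsWeaklyMixing G μ) (hF : IsFolnerSeq F)
    {φ : H →+ G} (hφ : Function.Surjective φ) :
    Tendsto φ (densityOne F) (mixingFilter G μ) :=
  tendsto_comap_iff.2 <| h.tendsto_multiMixingFilter hF (Φ := AddMonoidHom.pi fun _ : Fin 1 => φ)
    fun y => (hφ (y 0)).imp fun x hx => funext fun i => by rw [Subsingleton.elim i 0, ← hx]; rfl

end WeakMixing

section MixingImpliesErgodic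

theorem hasSum_measureReal_iUnion {Y : Type*} [MeasurableSpace Y] {ν : Measure Y}
    [IsFiniteMeasure ν] {f : ℕ → Set Y} (hd : Pairwise (Function.onFun Disjoint f))
    (hf : ∀ k, MeasurableSet (f k)) : HasSum (fun k => ν.real (f k)) (ν.real (⋃ k, f k)) := by
  have hsum : ∑' k, ν (f k) ≠ ⊤ := measure_iUnion hd hf ▸ measure_ne_top ν _
  rw [measureReal_def, measure_iUnion hd hf,
    ENNReal.tsum_toReal_eq fun k => measure_ne_top ν (f k)]
  exact ENNReal.hasSum_toReal hsum

variable {G Y ι : Type*} [AddCommGroup G] [AddAction G Y] [MeasurableSpace Y] {ν : Measure Y}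
  [IsProbabilityMeasure ν] {l : Filter ι} {γ : ι → G}

theorem ergodicVAdd_of_tendsto_inter_self [VAddInvariantMeasure G Y ν] [l.NeBot]
    (h : ∀ S : Set Y, MeasurableSet S →
      Tendsto (fun i => ν.real (S ∩ (γ i +ᵥ S))) l (𝓝 (ν.real S * ν.real S))) :
    ErgodicVAdd G Y ν where
  aeconst_of_forall_preimage_vadd_ae_eq {S} hS hinv := by
    have hconst (i : ι) : ν.real (S ∩ (γ i +ᵥ S)) = ν.real S := by
      have hγ : (γ i +ᵥ S : Set Y) =ᵐ[ν] S := by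
        simpa only [Set.preimage_vadd, neg_neg] using hinv (-γ i)
      exact measureReal_congr (by simpa only [Set.inter_self] using (ae_eq_refl S).inter hγ)
    have hsq : ν.real S = ν.real S * ν.real S :=
      tendsto_nhds_unique (by simpa only [hconst] using tendsto_const_nhds) (h S hS)
    rw [eventuallyConst_set', ae_eq_empty, eventuallyEq_univ, mem_ae_iff,
      ← measureReal_eq_zero_iff, ← measureReal_eq_zero_iff, probReal_compl_eq_one_sub hS,
      sub_eq_zero, eq_comm (a := (1 : ℝ)), or_comm]
    exact (IsIdempotentElem.iff_eq_zero_or_one.1 hsq.symm).symm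

variable [MeasurableConstVAdd G Y] [VAddInvariantMeasure G Y ν]

theorem tendsto_inter_vadd_of_isPiSystem_right {𝒞 : Set (Set Y)}
    (hgen : ‹MeasurableSpace Y› = MeasurableSpace.generateFrom 𝒞) (hpi : IsPiSystem 𝒞)
    {S : Set Y} (hS : MeasurableSet S)
    (h : ∀ R ∈ 𝒞, Tendsto (fun i => ν.real (S ∩ (γ i +ᵥ R))) l (𝓝 (ν.real S * ν.real R)))
    {R : Set Y} (hR : MeasurableSet R) :
    Tendsto (fun i => ν.real (S ∩ (γ i +ᵥ R))) l (𝓝 (ν.real S * ν.real R)) := by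
  induction R, hR using MeasurableSpace.induction_on_inter hgen hpi with
  | empty =>
    simpa only [Set.vadd_set_empty, Set.inter_empty, measureReal_empty, mul_zero] using
      tendsto_const_nhds
  | basic R hR => exact h R hR
  | compl R hR ih =>
    rw [probReal_compl_eq_one_sub hR, mul_one_sub]
    refine (ih.const_sub _).congr fun i => ?_
    rw [Set.vadd_set_compl, ← Set.sdiff_eq, sub_eq_iff_eq_add',
      measureReal_inter_add_sdiff (hR.const_vadd (γ i))]
  | iUnion f hd hf ih =>
    have hsum := hasSum_measureReal_iUnion (ν := ν) hd hf
    have hlim := tendsto_tsum_of_dominated_convergence hsum.summable ih (.of_forall fun i k => ?_)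
    · rw [tsum_mul_left, hsum.tsum_eq] at hlim
      refine hlim.congr fun i => ?_
      rw [Set.vadd_set_iUnion, Set.inter_iUnion]
      exact (hasSum_measureReal_iUnion (fun a b hab => (Set.disjoint_vadd_set.2 (hd hab)).mono
        Set.inter_subset_right Set.inter_subset_right)
        fun k => hS.inter ((hf k).const_vadd _)).tsum_eq
    · rw [Real.norm_of_nonneg measureReal_nonneg, ← measureReal_vadd_set (γ i) (f k)]
      exact measureReal_mono Set.inter_subset_right

theorem tendsto_inter_vadd_of_isPiSystem {𝒞 : Set (Set Y)}
    (hgen : ‹MeasurableSpace Y› = MeasurableSpace.generateFrom 𝒞) (hpi : IsPiSystem 𝒞)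
    (h : ∀ R ∈ 𝒞, ∀ R' ∈ 𝒞,
      Tendsto (fun i => ν.real (R ∩ (γ i +ᵥ R'))) l (𝓝 (ν.real R * ν.real R')))
    {S S' : Set Y} (hS : MeasurableSet S) (hS' : MeasurableSet S') :
    Tendsto (fun i => ν.real (S ∩ (γ i +ᵥ S'))) l (𝓝 (ν.real S * ν.real S')) := by
  have hmeas {R : Set Y} (hR : R ∈ 𝒞) : MeasurableSet R :=
    hgen ▸ MeasurableSpace.measurableSet_generateFrom hR
  have hright (R : Set Y) (hR : R ∈ 𝒞) :
      Tendsto (fun i => ν.real (S' ∩ (-γ i +ᵥ R))) l (𝓝 (ν.real S' * ν.real R)) := by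
    simpa only [measureReal_inter_neg_vadd_set, mul_comm] using
      tendsto_inter_vadd_of_isPiSystem_right hgen hpi (hmeas hR) (h R hR) hS'
  simpa only [measureReal_inter_neg_vadd_set, mul_comm] using
    tendsto_inter_vadd_of_isPiSystem_right hgen hpi hS' hright hS

end MixingImpliesErgodic

section MixingImpliesWeakMixing

variable {G X : Type*} [AddCommGroup G] [AddAction G X] [MeasurableSpace X]
  [MeasurableConstVAdd G X] {μ : Measure X} [IsProbabilityMeasure μ] [VAddInvariantMeasure G X μ]

theorem isWeaklyMixing_of_neBot_mixingFilter [(mixingFilter G μ).NeBot] : IsWeaklyMixing G μ := by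
  have hinv : VAddInvariantMeasure G (X × X) (μ.prod μ) :=
    ⟨fun g s hs => ((measurePreserving_vadd g μ).prod
      (measurePreserving_vadd g μ)).measure_preimage hs.nullMeasurableSet⟩
  refine ergodicVAdd_of_tendsto_inter_self (l := mixingFilter G μ) (γ := id) fun S hS => ?_
  refine tendsto_inter_vadd_of_isPiSystem generateFrom_prod.symm isPiSystem_prod ?_ hS hS
  rintro _ ⟨A, hA : MeasurableSet A, B, hB : MeasurableSet B, rfl⟩
    _ ⟨A', hA' : MeasurableSet A', B', hB' : MeasurableSet B', rfl⟩
  have hmix := tendsto_mixingFilter_iff.1 (tendsto_id (x := mixingFilter G μ))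
  simp only [Set.vadd_set_prod, Set.prod_inter_prod, measureReal_prod_prod]
  rw [mul_mul_mul_comm]
  exact (hmix A A' hA hA').mul (hmix B B' hB hB')

theorem isWeaklyMixing_of_neBot_multiMixingFilter {n : ℕ} (hn : 0 < n)
    [(multiMixingFilter G μ n).NeBot] : IsWeaklyMixing G μ :=
  have := (tendsto_apply_multiMixingFilter (G := G) (μ := μ) (⟨0, hn⟩ : Fin n)).neBot
  isWeaklyMixing_of_neBot_mixingFilter

theorem isWeaklyMixing_of_hasUniformDensityOne {n : ℕ} (hn : 0 < n)
    {F : ℕ → Finset (Fin n → G)} (hF : IsFolnerSeq F)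
    (h : ∀ A : Fin (n + 1) → Set X, (∀ j, MeasurableSet (A j)) →
      ∀ ε : ℝ, 0 < ε → HasUniformDensityOne (mixingSet G μ A ε)) : IsWeaklyMixing G μ := by
  have hlim : Tendsto id (densityOne F) (multiMixingFilter G μ n) :=
    tendsto_multiMixingFilter_iff.2 fun A hA => Metric.tendsto_nhds.2 fun ε hε =>
      hasUniformDensityOne_iff.1 (h A hA ε hε) F hF
  have := hF.neBot_densityOne
  have := hlim.neBot
  exact isWeaklyMixing_of_neBot_multiMixingFilter hn

theorem HasRLim.tendsto {Z : Type*} [PseudoMetricSpace Z] {m : ℕ}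
    {x : Set.powersetCard ℕ m → Z} {a : Z} (h : HasRLim x a) :
    Tendsto (fun n => x ⟨(Finset.range m).map (addRightEmbedding n), by simp⟩) atTop (𝓝 a) := by
  refine Metric.tendsto_atTop.2 fun ε hε => ?_
  obtain ⟨α₀, hα₀⟩ := h ε hε
  refine ⟨(α₀ : Finset ℕ).sup id + 1, fun n hn => hα₀ _ fun i hi k hk => ?_⟩
  obtain ⟨j, -, rfl⟩ := Finset.mem_map.1 hk
  have hle : i ≤ (α₀ : Finset ℕ).sup id := Finset.le_sup (f := id) hi
  rw [addRightEmbedding_apply]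
  lia

theorem isWeaklyMixing_of_hasRLim {n : ℕ} (hn : 0 < n) {m : ℕ}
    {g : Set.powersetCard ℕ m → Fin n → G}
    (h : ∀ A : Fin (n + 1) → Set X, (∀ j, MeasurableSet (A j)) →
      HasRLim (fun α => multiCorrelation μ A (g α)) (∏ j, μ.real (A j))) :
    IsWeaklyMixing G μ := by
  have := (tendsto_multiMixingFilter_iff.2 fun A hA => (h A hA).tendsto).neBot
  exact isWeaklyMixing_of_neBot_multiMixingFilter hn

end MixingImpliesWeakMixing

section Translates

open scoped BigOperators

variable {H : Type*} [AddCommGroup H] {F : ℕ → Finset H} {E : Set H}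

theorem relDensity_map_addRight (S : Finset H) (E : Set H) (x : H) :
    relDensity (S.map (addRightEmbedding x)) E = relDensity S ((· + x) ⁻¹' E) := by
  rw [relDensity_eq_expect, relDensity_eq_expect, Finset.expect_eq_sum_div_card,
    Finset.expect_eq_sum_div_card, Finset.sum_map, Finset.card_map]
  rfl

theorem IsFolnerSeq.map_addRight (hF : IsFolnerSeq F) (x : ℕ → H) :
    IsFolnerSeq fun k => (F k).map (addRightEmbedding (x k)) := by
  refine ⟨fun k => (hF.1 k).map, fun g => (hF.2 g).congr fun k => ?_⟩
  have hcoe : ((F k).map (addRightEmbedding (x k)) : Set H) = x k +ᵥ (F k : Set H) := by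
    simp only [Finset.coe_map, addRightEmbedding_apply, ← Set.image_vadd, vadd_eq_add, add_comm]
  rw [hcoe, vadd_comm, ← Set.vadd_set_inter, Set.ncard_vadd_set, Finset.card_map]

theorem IsFolnerSeq.tendsto_expect_relDensity_preimage_add_right (hF : IsFolnerSeq F) {d : ℝ}
    (hd : Tendsto (fun k => relDensity (F k) E) atTop (𝓝 d)) {S : Finset H} (hS : S.Nonempty) :
    Tendsto (fun k => 𝔼 x ∈ F k, relDensity S ((· + x) ⁻¹' E)) atTop (𝓝 d) := by
  classical
  have hswap (k : ℕ) : 𝔼 x ∈ F k, relDensity S ((· + x) ⁻¹' E) =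
      (∑ h ∈ S, relDensity (F k) ((· + h) ⁻¹' E)) / S.card := by
    rw [← Finset.expect_eq_sum_div_card]
    simp only [relDensity_eq_expect]
    rw [Finset.expect_comm]
    refine Finset.expect_congr rfl fun h _ => Finset.expect_congr rfl fun x _ => ?_
    simp only [Set.indicator_apply, Set.mem_preimage, Pi.one_apply, add_comm h x]
  have hshift (h : H) : Tendsto (fun k => relDensity (F k) ((· + h) ⁻¹' E)) atTop (𝓝 d) := by
    simpa only [sub_add_cancel, zero_add] using
      (hF.tendsto_relDensity_preimage_add_right_sub E h).add hd
  have hsum := (tendsto_finsetSum S fun h _ => hshift h).div_const (S.card : ℝ)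
  rw [Finset.sum_const, nsmul_eq_mul,
    mul_div_cancel_left₀ _ (Nat.cast_ne_zero.2 hS.card_ne_zero)] at hsum
  simpa only [hswap] using hsum

theorem IsFolnerSeq.frequently_densityOne_lt_of_tendsto_expect (hF : IsFolnerSeq F) {f : H → ℝ}
    (hf : 0 ≤ f) {a c : ℝ} (h : Tendsto (fun k => 𝔼 x ∈ F k, f x) atTop (𝓝 a)) (hac : a < c) :
    ∃ᶠ x in densityOne F, f x < c := by
  intro hfc
  have hlim := (hF.mem_densityOne_iff.1 hfc).const_mul c
  rw [mul_one] at hlim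
  refine hac.not_ge (le_of_tendsto_of_tendsto' hlim h fun k => ?_)
  -- Markov's inequality
  rw [relDensity_eq_expect, Finset.mul_expect]
  refine Finset.expect_le_expect fun x _ => ?_
  rw [Set.indicator_apply]
  split_ifs with hx
  · simpa only [Pi.one_apply, mul_one] using not_lt.1 hx
  · exact (mul_zero c).trans_le (hf x)

/-- The largest relative density of `E` in a translate of the finite set `S`. -/
def maxRelDensity (S : Finset H) (E : Set H) : ℝ :=
  ⨆ x : H, relDensity S ((· + x) ⁻¹' E)

theorem relDensity_preimage_add_right_le_maxRelDensity (S : Finset H) (E : Set H) (x : H) :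
    relDensity S ((· + x) ⁻¹' E) ≤ maxRelDensity S E :=
  le_ciSup (f := fun x => relDensity S ((· + x) ⁻¹' E))
    ⟨1, Set.forall_mem_range.2 fun _ => relDensity_le_one S _⟩ x

theorem relDensity_le_maxRelDensity (S : Finset H) (E : Set H) :
    relDensity S E ≤ maxRelDensity S E := by
  simpa only [add_zero, Set.preimage_id'] using
    relDensity_preimage_add_right_le_maxRelDensity S E 0

theorem maxRelDensity_le_one (S : Finset H) (E : Set H) : maxRelDensity S E ≤ 1 :=
  ciSup_le fun _ => relDensity_le_one S _

theorem IsFolnerSeq.exists_tendsto_maxRelDensity (hF : IsFolnerSeq F)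
    (hE : 0 < upperDensity F E) :
    ∃ d > 0, ∃ F₁ F₂ : ℕ → Finset H, IsFolnerSeq F₁ ∧ IsFolnerSeq F₂ ∧
      Tendsto (fun k => maxRelDensity (F₁ k) E) atTop (𝓝 d) ∧
      Tendsto (fun k => relDensity (F₂ k) E) atTop (𝓝 d) := by
  have hbdd : IsBoundedUnder (· ≤ ·) atTop fun k => maxRelDensity (F k) E :=
    isBoundedUnder_of ⟨1, fun k => maxRelDensity_le_one (F k) E⟩
  have hcobdd : IsCoboundedUnder (· ≤ ·) atTop fun k => maxRelDensity (F k) E :=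
    isCoboundedUnder_le_of_le atTop fun k =>
      (relDensity_nonneg (F k) E).trans (relDensity_le_maxRelDensity (F k) E)
  obtain ⟨φ, hlim, hφ⟩ := (MapClusterPt.limsup hcobdd hbdd).exists_seq_tendsto
  have hpos : 0 < limsup (fun k => maxRelDensity (F k) E) atTop := hE.trans_le <|
    limsup_le_limsup (.of_forall fun k => relDensity_le_maxRelDensity (F k) E)
      (isCoboundedUnder_relDensity F E) hbdd
  choose x hx using fun k : ℕ => exists_lt_of_lt_ciSup
    (show maxRelDensity (F (φ k)) E - 1 / (k + 1) < maxRelDensity (F (φ k)) E from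
      sub_lt_self _ Nat.one_div_pos_of_nat)
  refine ⟨_, hpos, F ∘ φ, _, hF.comp hφ, (hF.comp hφ).map_addRight x, hlim, ?_⟩
  have hlower := hlim.sub (tendsto_one_div_add_atTop_nhds_zero_nat (𝕜 := ℝ))
  rw [sub_zero] at hlower
  refine tendsto_of_tendsto_of_tendsto_of_le_of_le hlower hlim (fun k => ?_) fun k => ?_
  · exact (hx k).le.trans_eq (relDensity_map_addRight _ E (x k)).symm
  · exact (relDensity_map_addRight _ E (x k)).trans_le
      (relDensity_preimage_add_right_le_maxRelDensity _ E (x k))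

theorem IsFolnerSeq.exists_frequently_densityOne_le_relDensity (hF : IsFolnerSeq F)
    (hE : 0 < upperDensity F E) :
    ∃ c > 0, ∃ F₁ F₂ : ℕ → Finset H, IsFolnerSeq F₁ ∧ IsFolnerSeq F₂ ∧
      ∀ N : ℕ, ∃ᶠ x in densityOne F₂, ∀ i < N, c ≤ relDensity (F₁ i) ((· + x) ⁻¹' E) := by
  obtain ⟨d, hd, F₁, F₂, hF₁, hF₂, hmax, hdens⟩ := hF.exists_tendsto_maxRelDensity hE
  obtain ⟨φ, hφ, hφd⟩ := extraction_forall_of_eventually fun i : ℕ =>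
    Metric.tendsto_nhds.1 hmax (d / 8 * (1 / 2) ^ i) (by positivity)
  refine ⟨d / 4, by positivity, F₁ ∘ φ, F₂, hF₁.comp hφ.tendsto_atTop, hF₂, fun N => ?_⟩
  let deficit (i : ℕ) (x : H) : ℝ :=
    maxRelDensity (F₁ (φ i)) E - relDensity (F₁ (φ i)) ((· + x) ⁻¹' E)
  have hdeficit (i : ℕ) (x : H) : 0 ≤ deficit i x :=
    sub_nonneg.2 (relDensity_preimage_add_right_le_maxRelDensity _ E x)
  have hmean (i : ℕ) : Tendsto (fun k => 𝔼 x ∈ F₂ k, deficit i x) atTop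
      (𝓝 (maxRelDensity (F₁ (φ i)) E - d)) := by
    simpa only [deficit, Finset.expect_sub_distrib, Finset.expect_const (hF₂.1 _)] using
      (hF₂.tendsto_expect_relDensity_preimage_add_right hdens (hF₁.1 (φ i))).const_sub _
  have hsum : Tendsto (fun k => 𝔼 x ∈ F₂ k, ∑ i ∈ Finset.range N, deficit i x) atTop
      (𝓝 (∑ i ∈ Finset.range N, (maxRelDensity (F₁ (φ i)) E - d))) := by
    simpa only [Finset.expect_sum_comm] using tendsto_finsetSum _ fun i _ => hmean i
  have hlt : ∑ i ∈ Finset.range N, (maxRelDensity (F₁ (φ i)) E - d) < d / 2 :=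
    calc ∑ i ∈ Finset.range N, (maxRelDensity (F₁ (φ i)) E - d)
        ≤ ∑ i ∈ Finset.range N, d / 8 * (1 / 2) ^ i :=
          Finset.sum_le_sum fun i _ => (le_abs_self _).trans (hφd i).le
      _ ≤ d / 8 * 2 := by
          rw [← Finset.mul_sum]
          gcongr
          exact sum_geometric_two_le N
      _ < d / 2 := by linarith
  refine (hF₂.frequently_densityOne_lt_of_tendsto_expect
    (fun x => Finset.sum_nonneg fun i _ => hdeficit i x) hsum hlt).mono fun x hx i hi => ?_
  have hsmall : deficit i x < d / 2 := (Finset.single_le_sum (fun i _ => hdeficit i x)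
    (Finset.mem_range.2 hi)).trans_lt hx
  have hclose : d - d / 8 * (1 / 2) ^ i < maxRelDensity (F₁ (φ i)) E := by
    linarith [neg_lt_of_abs_lt (hφd i)]
  have hpow : d / 8 * (1 / 2) ^ i ≤ d / 8 :=
    mul_le_of_le_one_right (by positivity) (pow_le_one₀ (by norm_num) (by norm_num))
  simp only [deficit] at hsmall
  simp only [Function.comp_apply]
  linarith

end Translates

section SumsInDenseSets

variable {H : Type*} [AddCommGroup H] [Countable H] {F : ℕ → Finset H} {E : Set H}
  {𝓛 : Filter H} [𝓛.IsCountablyGenerated]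

theorem IsFolnerSeq.exists_tendsto_forall_eventually_add_mem (hF : IsFolnerSeq F)
    (hE : 0 < upperDensity F E)
    (h𝓛 : ∀ F : ℕ → Finset H, IsFolnerSeq F → densityOne F ≤ 𝓛) :
    ∃ F' : ℕ → Finset H, IsFolnerSeq F' ∧ ∃ E' : Set H, 0 < upperDensity F' E' ∧
      ∃ y : ℕ → H, Tendsto y atTop 𝓛 ∧ ∀ x ∈ E', ∀ᶠ k in atTop, x + y k ∈ E := by
  classical
  obtain ⟨c, hc, F₁, F₂, hF₁, hF₂, hfreq⟩ := hF.exists_frequently_densityOne_le_relDensity hE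
  obtain ⟨D, hD⟩ := 𝓛.exists_antitone_basis
  choose y hyc hyD using fun k => ((hfreq k).and_eventually (h𝓛 F₂ hF₂ (hD.mem k))).exists
  obtain ⟨ω, φ, hφ, hlim⟩ :=
    CompactSpace.tendsto_subseq fun k => fun x : H => decide (x + y k ∈ E)
  have hω (x : H) : ∀ᶠ k in atTop, (x + y (φ k) ∈ E ↔ ω x = true) := by
    have hx : Tendsto (fun k => decide (x + y (φ k) ∈ E)) atTop (𝓝 (ω x)) :=
      tendsto_pi_nhds.1 hlim x
    rw [nhds_discrete, tendsto_pure] at hx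
    exact hx.mono fun k hk => by rw [← hk, decide_eq_true_iff]
  refine ⟨F₁, hF₁, {x | ω x = true}, hc.trans_le ?_, y ∘ φ,
    (hD.tendsto hyD).comp hφ.tendsto_atTop, fun x hx => (hω x).mono fun k hk => hk.2 hx⟩
  refine le_limsup_of_frequently_le (.of_forall fun i => ?_) (isBoundedUnder_relDensity F₁ _)
  obtain ⟨k, hk, hik⟩ := (((F₁ i).eventually_all.2 fun x _ => hω x).and
    (hφ.tendsto_atTop.eventually_gt_atTop i)).exists
  refine (hyc (φ k) i hik).trans_eq ?_
  rw [← relDensity, relDensity_eq_expect, relDensity_eq_expect]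
  refine Finset.expect_congr rfl fun x hx => ?_
  simp only [Set.indicator_apply, Set.mem_preimage, Set.mem_ofPred_eq, hk x hx]

theorem IsFolnerSeq.exists_seq_sum_mem (hF : IsFolnerSeq F) (hE : 0 < upperDensity F E)
    (h𝓛 : ∀ F : ℕ → Finset H, IsFolnerSeq F → densityOne F ≤ 𝓛) (m : ℕ) :
    ∃ x : ℕ → Fin (m + 1) → H, (∀ t, Tendsto (fun k => x k t) atTop 𝓛) ∧
      ∀ κ : Fin (m + 1) → ℕ, StrictMono κ → ∑ t, x (κ t) t ∈ E := by
  induction m generalizing F E with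
  | zero =>
    obtain ⟨D, hD⟩ := 𝓛.exists_antitone_basis
    choose x hxE hxD using fun k => ((frequently_densityOne_of_upperDensity_pos hE).and_eventually
      (h𝓛 F hF (hD.mem k))).exists
    exact ⟨fun k _ => x k, fun _ => hD.tendsto hxD, fun κ _ => by simpa using hxE (κ 0)⟩
  | succ m ih =>
    obtain ⟨F', hF', E', hE', y, hy, hyE⟩ := hF.exists_tendsto_forall_eventually_add_mem hE h𝓛
    obtain ⟨x, hx, hxE⟩ := ih hF' hE'
    -- `y (φ k)` only has to work for the finitely many sums of terms `x i t` with `i < k`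
    have hfin (k : ℕ) : {κ : Fin (m + 1) → ℕ | ∀ t, κ t < k}.Finite := by
      simpa only [Set.mem_Iio] using Set.Finite.pi' fun _ => Set.finite_Iio k
    obtain ⟨φ, hφ, hφE⟩ := extraction_forall_of_eventually fun k : ℕ =>
      ((hfin k).subset (Set.sep_subset _ StrictMono)).eventually_all.2 fun κ hκ =>
        hyE _ (hxE κ hκ.2)
    refine ⟨fun k => Fin.snoc (x k) (y (φ k)), fun t => ?_, fun κ hκ => ?_⟩
    · induction t using Fin.lastCases with
      | last => simpa only [Fin.snoc_last, Function.comp_def] using hy.comp hφ.tendsto_atTop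
      | cast t => simpa only [Fin.snoc_castSucc] using hx t
    · have hsum := hφE (κ (Fin.last (m + 1))) (κ ∘ Fin.castSucc)
        ⟨fun t => hκ (Fin.castSucc_lt_last t), hκ.comp Fin.strictMono_castSucc⟩
      rw [Fin.sum_univ_castSucc]
      simpa only [Fin.snoc_castSucc, Fin.snoc_last, Function.comp_apply] using hsum

end SumsInDenseSets

section Separation

variable {G ι : Type*} [AddCommGroup G] {𝓜 : Filter G} {n : ℕ}

/-- The filter on `G ^ n` along which all coordinates, and all differences of two distinct
coordinates, converge along the filter `𝓜` on `G`. -/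
def separatingFilter (𝓜 : Filter G) (n : ℕ) : Filter (Fin n → G) :=
  (⨅ j, comap (fun g => g j) 𝓜) ⊓ ⨅ i, ⨅ j, ⨅ _ : i ≠ j, comap (fun g => g j - g i) 𝓜

theorem tendsto_separatingFilter {l : Filter ι} {γ : ι → Fin n → G} :
    Tendsto γ l (separatingFilter 𝓜 n) ↔ (∀ j, Tendsto (fun k => γ k j) l 𝓜) ∧
      ∀ i j, i ≠ j → Tendsto (fun k => γ k j - γ k i) l 𝓜 := by
  simp only [separatingFilter, tendsto_inf, tendsto_iInf, tendsto_comap_iff, Function.comp_def]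

theorem isCountablyGenerated_separatingFilter [𝓜.IsCountablyGenerated] :
    (separatingFilter 𝓜 n).IsCountablyGenerated := by
  unfold separatingFilter
  infer_instance

theorem surjective_eval_sub {i j : Fin n} (hij : i ≠ j) :
    Function.Surjective
      (Pi.evalAddMonoidHom (fun _ : Fin n => G) j - Pi.evalAddMonoidHom (fun _ => G) i) :=
  fun a => ⟨Pi.single j a, by
    simp only [AddMonoidHom.sub_apply, Pi.evalAddMonoidHom_apply, Pi.single_eq_same,
      Pi.single_eq_of_ne hij, sub_zero]⟩

theorem densityOne_le_separatingFilter {F : ℕ → Finset (Fin n → G)}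
    (h : ∀ φ : (Fin n → G) →+ G, Function.Surjective φ → Tendsto φ (densityOne F) 𝓜) :
    densityOne F ≤ separatingFilter 𝓜 n := by
  refine tendsto_id'.1 (tendsto_separatingFilter.2 ⟨fun j => ?_, fun i j hij => ?_⟩)
  · exact h (Pi.evalAddMonoidHom (fun _ => G) j) (Function.surjective_eval j)
  · exact (h _ (surjective_eval_sub hij)).congr fun g => rfl

end Separation

section Forward

variable {G X : Type*} [AddCommGroup G] [MeasurableSpace X] [AddAction G X]
  [MeasurableConstVAdd G X] {μ : Measure X} [IsProbabilityMeasure μ] [VAddInvariantMeasure G X μ]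
  {n : ℕ}

theorem IsWeaklyMixing.hasUniformDensityOne_mixingSet (h : IsWeaklyMixing G μ)
    {A : Fin (n + 1) → Set X} (hA : ∀ j, MeasurableSet (A j)) {ε : ℝ} (hε : 0 < ε) :
    HasUniformDensityOne (mixingSet G μ A ε) :=
  hasUniformDensityOne_iff.2 fun _ hF =>
    Metric.tendsto_nhds.1 (tendsto_multiMixingFilter_iff.1 (h.tendsto_multiMixingFilter hF
      (Φ := AddMonoidHom.id _) Function.surjective_id) A hA) ε hε

variable [IsSeparable μ] {F : ℕ → Finset (Fin n → G)} {E : Set (Fin n → G)}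

theorem IsWeaklyMixing.exists_hasRLim (h : IsWeaklyMixing G μ) (hF : IsFolnerSeq F)
    (hE : 0 < upperDensity F E) :
    ∃ m : ℕ, 0 < m ∧ ∃ g : Fin n → ℕ → Fin m → G,
      (∀ α : Set.powersetCard ℕ m, (fun j => sumAlong (g j) α) ∈ E) ∧
      ∀ A : Fin (n + 1) → Set X, (∀ j, MeasurableSet (A j)) →
        HasRLim (fun α : Set.powersetCard ℕ m =>
          multiCorrelation μ A (fun j => sumAlong (g j) α)) (∏ j, μ.real (A j)) := by
  have := isCountablyGenerated_multiMixingFilter G (μ := μ) n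
  obtain ⟨D, hD⟩ := (multiMixingFilter G μ n).exists_antitone_basis
  choose x hxE hxD using fun k => ((frequently_densityOne_of_upperDensity_pos hE).and_eventually
    (h.tendsto_multiMixingFilter hF (Φ := AddMonoidHom.id _) Function.surjective_id
      (hD.mem k))).exists
  have hsum (α : Set.powersetCard ℕ 1) : ∃ k ∈ (α : Finset ℕ),
      (fun j => sumAlong (fun k (_ : Fin 1) => x k j) α) = x k :=
    ⟨_, Finset.orderEmbOfFin_mem _ (Set.powersetCard.card_eq α) 0, by
      simp only [sumAlong, Finset.univ_unique, Fin.default_eq_zero, Finset.sum_singleton]⟩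
  refine ⟨1, one_pos, fun j k _ => x k j, fun α => ?_, fun A hA ε hε => ?_⟩
  · obtain ⟨k, -, hk⟩ := hsum α
    exact hk ▸ hxE k
  · have hlim := tendsto_multiMixingFilter_iff.1 (hD.tendsto hxD) A hA
    obtain ⟨N, hN⟩ := Metric.tendsto_atTop.1 hlim ε hε
    refine ⟨⟨{N}, Finset.card_singleton N⟩, fun α hα => ?_⟩
    obtain ⟨k, hkα, hk⟩ := hsum α
    dsimp only
    rw [hk]
    exact hN k (hα N (Finset.mem_singleton_self N) k hkα).le

theorem IsWeaklyMixing.exists_mixing_sums [Countable G] [Infinite G] (h : IsWeaklyMixing G μ)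
    (hF : IsFolnerSeq F) (hE : 0 < upperDensity F E) {m : ℕ} (hm : 0 < m) :
    ∃ g : Fin n → ℕ → Fin m → G,
      (∀ j, NonDegenerated (g j)) ∧
      (∀ i j, i ≠ j → EssentiallyDistinct (g j) (g i)) ∧
      (∀ α : Set.powersetCard ℕ m, (fun j => sumAlong (g j) α) ∈ E) ∧
      (∀ t j, MixingProperty μ (fun k (x : X) => g j k t +ᵥ x)) ∧
      (∀ t i j, i ≠ j → MixingProperty μ (fun k (x : X) => (g j k t - g i k t) +ᵥ x)) := by
  have := isCountablyGenerated_mixingFilter G (μ := μ)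
  have : (cofinite : Filter G).IsCountablyGenerated :=
    HasCountableBasis.isCountablyGenerated ⟨hasBasis_cofinite, Set.Countable.ofPred_finite⟩
  set 𝓜 := cofinite ⊓ mixingFilter G μ
  have := isCountablyGenerated_separatingFilter (𝓜 := 𝓜) (n := n)
  obtain ⟨m, rfl⟩ := Nat.exists_eq_succ_of_ne_zero hm.ne'
  obtain ⟨x, hx, hxE⟩ := hF.exists_seq_sum_mem (𝓛 := separatingFilter 𝓜 n) hE
    (fun F hF => densityOne_le_separatingFilter fun φ hφ =>
      tendsto_inf.2 ⟨hF.tendsto_densityOne_cofinite hφ, h.tendsto_mixingFilter hF hφ⟩) m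
  have hcoord (t) (j : Fin n) := tendsto_inf.1 ((tendsto_separatingFilter.1 (hx t)).1 j)
  have hdiff (t) (i j : Fin n) (hij : i ≠ j) :=
    tendsto_inf.1 ((tendsto_separatingFilter.1 (hx t)).2 i j hij)
  refine ⟨fun j k t => x k t j, fun j t => (hcoord t j).1, fun i j hij t => (hdiff t i j hij).1,
    fun α => ?_, fun t j => mixingProperty_iff.2 (hcoord t j).2,
    fun t i j hij => mixingProperty_iff.2 (hdiff t i j hij).2⟩
  convert hxE _ ((α : Finset ℕ).orderEmbOfFin (Set.powersetCard.card_eq α)).strictMono using 1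
  funext j
  simp only [sumAlong, Finset.sum_apply]

end Forward

end

end AbelianMixing

theorem theorem6p2 {G X : Type*} [AddCommGroup G] [Countable G] [Infinite G]
    [MeasurableSpace X] (μ : Measure X) [IsProbabilityMeasure μ] [MeasureTheory.IsSeparable μ]
    [AddAction G X] [MeasurableConstVAdd G X] [VAddInvariantMeasure G X μ]
    (ℓ : ℕ) (hℓ : 0 < ℓ) :
    List.TFAE [
      -- (i)
      IsWeaklyMixing G μ,
      -- (ii)
      ∀ F : ℕ → Finset (Fin ℓ → G), IsFolnerSeq F →
        ∀ E : Set (Fin ℓ → G), 0 < upperDensity F E →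
        ∀ m : ℕ, 0 < m →
        ∃ g : Fin ℓ → ℕ → Fin m → G,
          (∀ j, NonDegenerated (g j)) ∧
          (∀ i j, i ≠ j → EssentiallyDistinct (g j) (g i)) ∧
          (∀ α : Set.powersetCard ℕ m, (fun j => sumAlong (g j) α) ∈ E) ∧
          (∀ t j, MixingProperty μ (fun k (x : X) => g j k t +ᵥ x)) ∧
          (∀ t i j, i ≠ j → MixingProperty μ (fun k (x : X) => (g j k t - g i k t) +ᵥ x)),
      -- (iii)
      ∀ F : ℕ → Finset (Fin ℓ → G), IsFolnerSeq F →
        ∀ E : Set (Fin ℓ → G), 0 < upperDensity F E →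
        ∃ m : ℕ, 0 < m ∧ ∃ g : Fin ℓ → ℕ → Fin m → G,
          (∀ α : Set.powersetCard ℕ m, (fun j => sumAlong (g j) α) ∈ E) ∧
          ∀ A : Fin (ℓ + 1) → Set X, (∀ j, MeasurableSet (A j)) →
            HasRLim (fun α : Set.powersetCard ℕ m =>
              multiCorrelation μ A (fun j => sumAlong (g j) α)) (∏ j, μ.real (A j)),
      -- (iv)
      ∀ A : Fin (ℓ + 1) → Set X, (∀ j, MeasurableSet (A j)) →
        ∀ ε : ℝ, 0 < ε → HasUniformDensityOne (mixingSet G μ A ε)] := by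
  obtain ⟨F, hF⟩ := exists_isFolnerSeq (Fin ℓ → G)
  have hpos : 0 < upperDensity F Set.univ := hF.upperDensity_univ ▸ one_pos
  tfae_have 1 → 2 := fun h F hF E hE m hm => h.exists_mixing_sums hF hE hm
  tfae_have 1 → 3 := fun h F hF E hE => h.exists_hasRLim hF hE
  tfae_have 1 → 4 := fun h A hA ε hε => h.hasUniformDensityOne_mixingSet hA hε
  tfae_have 2 → 1 := by
    intro h
    obtain ⟨g, -, -, -, hmix, -⟩ := h F hF Set.univ hpos 1 one_pos
    have := (mixingProperty_iff.1 (hmix 0 ⟨0, hℓ⟩)).neBot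
    exact isWeaklyMixing_of_neBot_mixingFilter
  tfae_have 3 → 1 := by
    intro h
    obtain ⟨m, -, g, -, hlim⟩ := h F hF Set.univ hpos
    exact isWeaklyMixing_of_hasRLim hℓ hlim
  tfae_have 4 → 1 := isWeaklyMixing_of_hasUniformDensityOne hℓ hF
  tfae_finish
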